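/- Let $\mathcal{X}$ be a measurable space (in particular $\mathbb{R}^d$ or a compact subset of it), let $\Pi$ be a probability measure on $\mathcal{X}$, and let $\mathcal{H}$ be a separable reproducing kernel Hilbert space of real functions on $\mathcal{X}$ with measurable kernel $k$. Assume that $\int k(x,x)\,\Pi(dx)<\infty$ and that $\mathcal{H}$ is dense in $L_2(\Pi)$. Let $(e_m)_m$ be a (finite or countably infinite) orthonormal basis of $L_2(\Pi)$ consisting of eigenfunctions of the integral operator $(\Sigma f)(x)=\int f(x')k(x,x')\,\Pi(dx')$, with eigenvalues $\mu_m$. For $\lambda>0$ put $$d(\lambda)=\sum_m\frac{\mu_m}{\mu_m+\lambda},$$ and let $\Pi_{\mathrm B}$ be the probability measure on $\mathcal{X}$ whose density with respect to $\Pi$ is proportional to $\sum_m\frac{\mu_m}{\mu_m+\lambda}e_m(x)^2$. Let $\delta\in(0,1)$, let $n\ge 5\,d(\lambda)\log\frac{16\,d(\lambda)}{\delta}$, and let $x_1,\dots,x_n$ be independent draws from $\Pi_{\mathrm B}$ for which the kernel matrix $K=(k(x_i,x_j))_{i,j}$ is almost surely invertible. Write $\Pi(f)=\int f\,d\Pi$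 and let $\hat\Pi(f)=\sum_{j=1}^n w_jf(x_j)$ be the kernel quadrature estimator, with weights $w=K^{-1}z$, $z_j=\int k(x,x_j)\,\Pi(dx)$. Then, with probability greater than $1-\delta$, $$|\hat\Pi(f)-\Pi(f)|\le 2\lambda^{1/2}\|f\|_{\mathcal{H}}\qquad\text{for all } f\in\mathcal{H}.$$ -/

import Mathlib

open MeasureTheory ProbabilityTheory
open scoped ENNReal

namespace KernelQuadrature

noncomputable section

/-- The real-valued reproducing kernel `k(x, y)` of a reproducing kernel Hilbert space `H` of real
functions on `S` (so `f x = ⟪k(·, x), f⟫` for all `f : H` and `x : S`). -/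
def kern {S : Type*} (H : Type*) [NormedAddCommGroup H] [InnerProductSpace ℝ H]
    [RKHS ℝ H S ℝ] [CompleteSpace H] (x y : S) : ℝ :=
  RKHS.kernel H x y (1 : ℝ)

/-- The integral operator `(Σ f)(x) = ∫ f(y) k(x, y) ν(dy)`. -/
def integralOp {S : Type*} [MeasurableSpace S] (k : S → S → ℝ) (ν : Measure S)
    (f : S → ℝ) (x : S) : ℝ :=
  ∫ y, f y * k x y ∂ν

/-- `H` is dense in `L²(ν)`: the classes of elements of `H` form a dense subset. -/
def DenseInL2 {S : Type*} [MeasurableSpace S] (H : Type*) [NormedAddCommGroup H]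
    [InnerProductSpace ℝ H] [RKHS ℝ H S ℝ] (ν : Measure S) : Prop :=
  Dense {g : Lp ℝ 2 ν | ∃ f : H, g =ᵐ[ν] fun x => f x}

/-- The orthonormal basis `e` of `L²(ν)` consists of eigenfunctions of the integral operator, with
eigenvalues `μ`. -/
def IsEigensystem {S : Type*} [MeasurableSpace S] {ι : Type*} (k : S → S → ℝ) (ν : Measure S)
    (μ : ι → ℝ) (e : HilbertBasis ι ℝ (Lp ℝ 2 ν)) : Prop :=
  ∀ i, integralOp k ν (e i) =ᵐ[ν] fun x => μ i * e i x

/-- The degrees of freedom `d(λ) = ∑ μ_m / (μ_m + λ)`. -/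
def degreesOfFreedom {ι : Type*} (μ : ι → ℝ) (lam : ℝ) : ℝ :=
  ∑' i, μ i / (μ i + lam)

/-- The unnormalised density `∑ μ_m / (μ_m + λ) e_m(x)²`. -/
def leverage {S : Type*} [MeasurableSpace S] {ι : Type*} {ν : Measure S}
    (μ : ι → ℝ) (e : HilbertBasis ι ℝ (Lp ℝ 2 ν)) (lam : ℝ) (x : S) : ℝ≥0∞ :=
  ∑' i, ENNReal.ofReal (μ i / (μ i + lam) * (e i x) ^ 2)

/-- The probability distribution whose density with respect to `ν` is proportional to
`∑ μ_m / (μ_m + λ) e_m(x)²`. -/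
def bachMeasure {S : Type*} [MeasurableSpace S] {ι : Type*} {ν : Measure S}
    (μ : ι → ℝ) (e : HilbertBasis ι ℝ (Lp ℝ 2 ν)) (lam : ℝ) : Measure S :=
  (∫⁻ x, leverage μ e lam x ∂ν)⁻¹ • ν.withDensity (leverage μ e lam)

/-- The kernel matrix `K_{ij} = k(x_i, x_j)`. -/
def gram {S : Type*} (k : S → S → ℝ) {n : ℕ} (x : Fin n → S) : Matrix (Fin n) (Fin n) ℝ :=
  Matrix.of fun i j => k (x i) (x j)

/-- The kernel quadrature weights `w = K⁻¹ z`, where `z_j = ∫ k(t, x_j) ν(dt)`. -/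
def weights {S : Type*} [MeasurableSpace S] (k : S → S → ℝ) (ν : Measure S) {n : ℕ}
    (x : Fin n → S) : Fin n → ℝ :=
  (gram k x)⁻¹.mulVec fun j => ∫ t, k t (x j) ∂ν

/-- The kernel quadrature estimator `∑ w_j f(x_j)` of `∫ f dν`. -/
def estimator {S : Type*} [MeasurableSpace S] (k : S → S → ℝ) (ν : Measure S) {n : ℕ}
    (x : Fin n → S) (f : S → ℝ) : ℝ :=
  ∑ j, weights k ν x j * f (x j)

end

end KernelQuadrature

/-! The estimator integrates exactly the kernel interpolant `p` of `f` at the nodes. Since `f - p`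
vanishes at the nodes and is orthogonal to `p`, its norm in `H` is at most that of `f`, and its
integral is at most its norm in L². Hence it suffices that, with high probability, every `g` in `H`
vanishing at the nodes satisfies `‖g‖² ≤ 4 λ ‖g‖_H²`, with the L² norm on the left
(`abs_estimator_sub_integral_le`).

Let `γ_i` be the coefficients of `g` along the normalised eigenfunctions in `H`, and put `c_i = μ_i
/ (μ_i + λ)`, `u_i = √(μ_i + λ) γ_i`. Then `T = ‖g‖²` in L² equals `∑ c_i u_i²`, and `∑ u_i² = T + λ
∑ γ_i²`. Vanishing at a node makes `u` orthogonal to the vector `feature` there, whose covariance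
under `bachMeasure` is `C = diag c`. If the empirical covariance is at least `C - 4/5`, then `T ≤
(4/5) (T + λ ∑ γ_i²)`, so `T ≤ 4 λ ‖g‖_H²` by Bessel.

The reweighting bounds the squared length of the features by `d = d(λ)`, which also bounds the trace
of `C`. A one-sided matrix Bernstein inequality (`measure_exists_lt_form_le`) therefore depends on
`d` and not on the dimension. It rests on Golden–Thompson and on the trace of `exp M - M - 1`, which
unlike that of `exp M` vanishes at `M = 0`. Finite sets of eigenfunctions suffice, because the
failure events increase with the set. If `d ≤ 4/5`, all `μ_i ≤ 4 λ` and no probability is needed. -/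

namespace KernelQuadrature

/-! ### The Lie product formula -/

open Filter Topology in
theorem norm_pow_sub_pow_le {𝔸 : Type*} [NormedRing 𝔸] [NormOneClass 𝔸] (U V : 𝔸) (R : ℝ) (hR : 1 ≤ R)
    (hU : ‖U‖ ≤ R) (hV : ‖V‖ ≤ R) (m : ℕ) : ‖U ^ m - V ^ m‖ ≤ m * R ^ m * ‖U - V‖ := by
  induction m with
  | zero => simp
  | succ m ih =>
    have e : U ^ (m + 1) - V ^ (m + 1) = (U ^ m - V ^ m) * U + V ^ m * (U - V) := by
      rw [pow_succ, pow_succ]; noncomm_ring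
    have hR0 : 0 ≤ R := by linarith
    have h1 : ‖V ^ m‖ ≤ R ^ (m + 1) := by
      refine (norm_pow_le V m).trans ((pow_le_pow_left₀ (norm_nonneg _) hV m).trans ?_)
      exact pow_le_pow_right₀ hR (Nat.le_succ m)
    calc ‖U ^ (m + 1) - V ^ (m + 1)‖ ≤ ‖U ^ m - V ^ m‖ * ‖U‖ + ‖V ^ m‖ * ‖U - V‖ := by
          rw [e]; exact (norm_add_le _ _).trans (add_le_add (norm_mul_le _ _) (norm_mul_le _ _))
      _ ≤ (m * R ^ m * ‖U - V‖) * R + R ^ (m + 1) * ‖U - V‖ := by gcongr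
      _ = (m + 1 : ℕ) * R ^ (m + 1) * ‖U - V‖ := by push_cast; ring

theorem norm_normedSpace_exp_le {𝔸 : Type*} [NormedRing 𝔸] [NormOneClass 𝔸] [NormedAlgebra ℝ 𝔸]
    [CompleteSpace 𝔸] (A : 𝔸) : ‖NormedSpace.exp A‖ ≤ Real.exp ‖A‖ := by
  have hs := Real.summable_pow_div_factorial ‖A‖
  have hle : ∀ n : ℕ, ‖((n.factorial : ℝ)⁻¹) • A ^ n‖ ≤ ‖A‖ ^ n / n.factorial := fun n => by
    rw [norm_smul, Real.norm_of_nonneg (by positivity), div_eq_inv_mul]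
    gcongr
    exact norm_pow_le A n
  rw [NormedSpace.exp_eq_tsum ℝ, Real.exp_eq_exp_ℝ, NormedSpace.exp_eq_tsum_div]
  exact (norm_tsum_le_tsum_norm (hs.of_nonneg_of_le (fun _ => norm_nonneg _) hle)).trans
    ((hs.of_nonneg_of_le (fun _ => norm_nonneg _) hle).tsum_le_tsum hle hs)

open Filter Topology in
/-- The Lie product formula. -/
theorem tendsto_exp_mul_exp_pow {𝔸 : Type*} [NormedRing 𝔸] [NormOneClass 𝔸] [NormedAlgebra ℝ 𝔸]
    [CompleteSpace 𝔸] (A B : 𝔸) :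
    Tendsto (fun m : ℕ => (NormedSpace.exp ((m : ℝ)⁻¹ • A) * NormedSpace.exp ((m : ℝ)⁻¹ • B)) ^ m)
      atTop (𝓝 (NormedSpace.exp (A + B))) := by
  let _ : NormedAlgebra ℚ 𝔸 := NormedAlgebra.restrictScalars ℚ ℝ 𝔸
  set F : ℝ → 𝔸 := fun t => NormedSpace.exp (t • A) * NormedSpace.exp (t • B)
    - NormedSpace.exp (t • (A + B)) with hF
  -- Both exponential curves have derivative `A + B` at `0`, so `m • F (1/m)` tends to zero, which
  -- beats the factor `m` lost in comparing `m`-th powers.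
  have hd : HasDerivAt F 0 0 := by
    have hA := hasDerivAt_exp_smul_const (𝕂 := ℝ) A (0 : ℝ)
    have hB := hasDerivAt_exp_smul_const (𝕂 := ℝ) B (0 : ℝ)
    have hC := hasDerivAt_exp_smul_const (𝕂 := ℝ) (A + B) (0 : ℝ)
    have h := (hA.mul hB).sub hC
    simp only [zero_smul, NormedSpace.exp_zero, mul_one, one_mul, sub_self] at h
    exact h
  have hF0 : F 0 = 0 := by simp [hF]
  have hinv : Tendsto (fun m : ℕ => (m : ℝ)⁻¹) atTop (𝓝[≠] 0) := by
    rw [tendsto_nhdsWithin_iff]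
    refine ⟨tendsto_inv_atTop_nhds_zero_nat, ?_⟩
    filter_upwards [eventually_gt_atTop 0] with m hm
    simp; omega
  have hs : Tendsto (fun m : ℕ => (m : ℝ) • F ((m : ℝ)⁻¹)) atTop (𝓝 0) := by
    have := hd.tendsto_slope.comp hinv
    refine this.congr fun m => ?_
    simp [slope, hF0]
  set r := ‖A‖ + ‖B‖
  have hn : Tendsto (fun m : ℕ => Real.exp r * ‖(m : ℝ) • F ((m : ℝ)⁻¹)‖) atTop (𝓝 0) := by
    simpa using (hs.norm.const_mul (Real.exp r))
  rw [tendsto_iff_norm_sub_tendsto_zero]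
  refine squeeze_zero' (Eventually.of_forall fun _ => norm_nonneg _) ?_ hn
  filter_upwards [eventually_gt_atTop 0] with m hm
  have hm' : (0 : ℝ) < m := by exact_mod_cast hm
  have e1 : NormedSpace.exp (A + B) = NormedSpace.exp ((m : ℝ)⁻¹ • (A + B)) ^ m := by
    rw [← NormedSpace.exp_nsmul, ← Nat.cast_smul_eq_nsmul ℝ, smul_smul, mul_inv_cancel₀ hm'.ne',
      one_smul]
  have hexp : ∀ Z : 𝔸, ‖NormedSpace.exp ((m : ℝ)⁻¹ • Z)‖ ≤ Real.exp ((m : ℝ)⁻¹ * ‖Z‖) := by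
    intro Z
    refine (norm_normedSpace_exp_le _).trans ?_
    rw [norm_smul, Real.norm_of_nonneg (by positivity)]
  rw [e1]
  -- With this common bound on the two bases, its `m`-th power is `exp r`, uniformly in `m`.
  refine (norm_pow_sub_pow_le _ _ (Real.exp ((m : ℝ)⁻¹ * r)) (Real.one_le_exp (by positivity))
    ?_ ?_ m).trans ?_
  · refine (norm_mul_le _ _).trans ((mul_le_mul (hexp A) (hexp B) (norm_nonneg _)
      (Real.exp_pos _).le).trans ?_)
    rw [← Real.exp_add, ← mul_add]
  · refine (hexp _).trans (Real.exp_le_exp.2 ?_)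
    gcongr
    exact norm_add_le _ _
  · rw [← Real.exp_nat_mul, ← mul_assoc, mul_inv_cancel₀ hm'.ne', one_mul, norm_smul,
      Real.norm_of_nonneg hm'.le]
    apply le_of_eq
    simp only [hF]
    ring

/-! ### Trace inequalities and spectral calculus for symmetric matrices -/

section Matrix

open Matrix

variable {m : Type*} [Fintype m]

theorem trace_transpose_mul_self_nonneg (A : Matrix m m ℝ) : 0 ≤ (Aᵀ * A).trace := by
  simpa using (posSemidef_conjTranspose_mul_self A).trace_nonneg

theorem two_mul_trace_mul_le (A B : Matrix m m ℝ) :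
    2 * (Aᵀ * B).trace ≤ (Aᵀ * A).trace + (Bᵀ * B).trace := by
  have h := trace_transpose_mul_self_nonneg (A - B)
  have h2 : (Bᵀ * A).trace = (Aᵀ * B).trace := by
    rw [← trace_transpose (Bᵀ * A)]; simp
  simp only [transpose_sub, Matrix.sub_mul, Matrix.mul_sub, trace_sub] at h
  linarith

variable [DecidableEq m]

theorem trace_mul_pow_comm (A B : Matrix m m ℝ) (k : ℕ) :
    ((A * B) ^ k).trace = ((B * A) ^ k).trace := by
  cases k with
  | zero => simp
  | succ k =>
    have : (A * B) ^ (k + 1) = A * ((B * A) ^ k * B) := by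
      induction k with
      | zero => simp
      | succ k ih => rw [pow_succ, ih, pow_succ (B * A) k]; noncomm_ring
    rw [this, trace_mul_comm, pow_succ, Matrix.mul_assoc]

/-- The two claims feed each other. For the first, apply it to `M * M`, cycle the trace to reach
`(MᵀM)(MMᵀ)`, then use the second claim and Cauchy–Schwarz in AM–GM form. For the second, apply the
first to `P * Q`, cycle to `P² Q²`, and use the second for `P²` and `Q²`. No positivity of `P` or
`Q` is needed. -/
theorem trace_pow_two_pow_le (k : ℕ) :
    (∀ M : Matrix m m ℝ, (M ^ 2 ^ (k + 1)).trace ≤ ((Mᵀ * M) ^ 2 ^ k).trace) ∧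
    ∀ P Q : Matrix m m ℝ, Pᵀ = P → Qᵀ = Q →
      ((P * Q) ^ 2 ^ k).trace ≤ (P ^ 2 ^ k * Q ^ 2 ^ k).trace := by
  induction k with
  | zero =>
    refine ⟨fun M => ?_, fun P Q _ _ => by simp⟩
    have := two_mul_trace_mul_le Mᵀ M
    rw [transpose_transpose, trace_mul_comm M Mᵀ] at this
    simp only [zero_add, pow_one, pow_zero, pow_two]
    linarith
  | succ k ih =>
    obtain ⟨iha, ihb⟩ := ih
    refine ⟨fun M => ?_, fun P Q hP hQ => ?_⟩
    · have h1 := iha (M * M)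
      have e1 : (M * M) ^ 2 ^ (k + 1) = M ^ 2 ^ (k + 1 + 1) := by
        rw [← pow_two, ← pow_mul]; congr 1; ring
      have e2 : (((M * M)ᵀ * (M * M)) ^ 2 ^ k).trace
          = (((Mᵀ * M) * (M * Mᵀ)) ^ 2 ^ k).trace := by
        rw [transpose_mul, Matrix.mul_assoc, trace_mul_pow_comm]
        congr 2; noncomm_ring
      have h2 := ihb (Mᵀ * M) (M * Mᵀ) (by simp) (by simp)
      have h3 := two_mul_trace_mul_le ((Mᵀ * M) ^ 2 ^ k) ((M * Mᵀ) ^ 2 ^ k)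
      have e3 : ((Mᵀ * M) ^ 2 ^ k)ᵀ = (Mᵀ * M) ^ 2 ^ k := by simp [transpose_pow]
      have e4 : ((M * Mᵀ) ^ 2 ^ k)ᵀ = (M * Mᵀ) ^ 2 ^ k := by simp [transpose_pow]
      have e5 : ∀ A : Matrix m m ℝ, A ^ 2 ^ k * A ^ 2 ^ k = A ^ 2 ^ (k + 1) := fun A => by
        rw [← pow_add]; congr 1; ring
      rw [e3, e4, e5, e5, trace_mul_pow_comm M Mᵀ] at h3
      rw [e1, e2] at h1
      linarith
    · have h1 := iha (P * Q)
      have e2 : (((P * Q)ᵀ * (P * Q)) ^ 2 ^ k).trace = (((P * P) * (Q * Q)) ^ 2 ^ k).trace := by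
        rw [transpose_mul, hP, hQ, Matrix.mul_assoc, trace_mul_pow_comm]
        congr 2; noncomm_ring
      have h2 := ihb (P * P) (Q * Q) (by simp [hP]) (by simp [hQ])
      have e5 : ∀ A : Matrix m m ℝ, (A * A) ^ 2 ^ k = A ^ 2 ^ (k + 1) := fun A => by
        rw [← pow_two, ← pow_mul]; congr 1; ring
      rw [e5, e5] at h2
      linarith

open Filter Topology in
/-- The Golden–Thompson inequality for real symmetric matrices. -/
theorem trace_exp_add_le {A B : Matrix m m ℝ} (hA : Aᵀ = A) (hB : Bᵀ = B) :
    (NormedSpace.exp (A + B)).trace ≤ (NormedSpace.exp A * NormedSpace.exp B).trace := by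
  rcases isEmpty_or_nonempty m with hm | hm
  · simp [Matrix.trace]
  let _ : NormedRing (Matrix m m ℝ) := Matrix.linftyOpNormedRing
  let _ : NormedAlgebra ℝ (Matrix m m ℝ) := Matrix.linftyOpNormedAlgebra
  have : NormOneClass (Matrix m m ℝ) := Matrix.linfty_opNormOneClass
  -- The trace inequality is available for dyadic exponents only, so the Lie formula is used along
  -- `2 ^ k`.
  have ht := (tendsto_exp_mul_exp_pow A B).comp
    (tendsto_pow_atTop_atTop_of_one_lt (r := 2) one_lt_two)
  have ht' : Tendsto (fun k : ℕ => ((NormedSpace.exp ((((2 ^ k : ℕ) : ℝ))⁻¹ • A)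
      * NormedSpace.exp ((((2 ^ k : ℕ) : ℝ))⁻¹ • B)) ^ 2 ^ k).trace) atTop
      (𝓝 (NormedSpace.exp (A + B)).trace) :=
    ((continuous_id.matrix_trace).tendsto _).comp ht
  refine le_of_tendsto' ht' fun k => ?_
  have hk : (((2 ^ k : ℕ) : ℝ)) ≠ 0 := by positivity
  have e : ∀ Z : Matrix m m ℝ, NormedSpace.exp ((((2 ^ k : ℕ) : ℝ))⁻¹ • Z) ^ 2 ^ k
      = NormedSpace.exp Z := fun Z => by
    rw [← Matrix.exp_nsmul, ← Nat.cast_smul_eq_nsmul ℝ, smul_smul, mul_inv_cancel₀ hk, one_smul]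
  refine ((trace_pow_two_pow_le k).2 _ _ ?_ ?_).trans_eq ?_
  · rw [← Matrix.exp_transpose, transpose_smul, hA]
  · rw [← Matrix.exp_transpose, transpose_smul, hB]
  · rw [e, e]

/-- The spectral decomposition of a real symmetric matrix and of its exponential. -/
theorem exists_diagonalization {A : Matrix m m ℝ} (hA : A.IsHermitian) :
    ∃ U : Matrix m m ℝ, Uᴴ * U = 1 ∧ U * Uᴴ = 1 ∧ A = U * diagonal hA.eigenvalues * Uᴴ ∧
      NormedSpace.exp A = U * diagonal (fun i => Real.exp (hA.eigenvalues i)) * Uᴴ := by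
  have e : A = (hA.eigenvectorUnitary : Matrix m m ℝ) * diagonal hA.eigenvalues *
      (hA.eigenvectorUnitary : Matrix m m ℝ)ᴴ := by
    conv_lhs => rw [hA.spectral_theorem]
    rfl
  have h1 : (hA.eigenvectorUnitary : Matrix m m ℝ)ᴴ * (hA.eigenvectorUnitary : Matrix m m ℝ) = 1 :=
    Matrix.UnitaryGroup.star_mul_self hA.eigenvectorUnitary
  generalize (hA.eigenvectorUnitary : Matrix m m ℝ) = U at e h1
  refine ⟨U, h1, mul_eq_one_comm.1 h1, e, ?_⟩
  have h2 : U⁻¹ = Uᴴ := Matrix.inv_eq_left_inv h1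
  have h3 : IsUnit U := (Matrix.isUnit_iff_isUnit_det _).2 (Matrix.isUnit_det_of_left_inverse h1)
  conv_lhs => rw [e, ← h2, Matrix.exp_conj _ _ h3, Matrix.exp_diagonal, h2]
  congr 3
  ext i
  simp [Real.exp_eq_exp_ℝ]

theorem trace_mul_nonneg {A B : Matrix m m ℝ} (hA : A.PosSemidef) (hB : B.PosSemidef) :
    0 ≤ (A * B).trace := by
  obtain ⟨U, -, -, e, -⟩ := exists_diagonalization hB.1
  rw [e, ← Matrix.mul_assoc, trace_mul_comm, ← Matrix.mul_assoc, ← Matrix.mul_assoc]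
  simp only [Matrix.trace, diag_apply, mul_diagonal]
  exact Finset.sum_nonneg fun i _ => mul_nonneg (hA.conjTranspose_mul_mul_same U).diag_nonneg
    (hB.eigenvalues_nonneg i)

theorem eigenvalue_le_of_form_le {A : Matrix m m ℝ} (hA : A.IsHermitian) {r : ℝ}
    (h : ∀ v : m → ℝ, v ⬝ᵥ A *ᵥ v ≤ r * (v ⬝ᵥ v)) (i : m) : hA.eigenvalues i ≤ r := by
  have h1 := h (hA.eigenvectorBasis i)
  have h2 := hA.mulVec_eigenvectorBasis i
  have h3 : (hA.eigenvectorBasis i : m → ℝ) ⬝ᵥ (hA.eigenvectorBasis i : m → ℝ) = 1 := by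
    have := hA.eigenvectorBasis.orthonormal.1 i
    have h4 := EuclideanSpace.real_norm_sq_eq (hA.eigenvectorBasis i)
    rw [this] at h4
    simp only [dotProduct, ← pow_two]
    linarith
  rw [h2, dotProduct_smul, h3] at h1
  simpa using h1

/-- The form bound puts all eigenvalues below `r`; in an eigenbasis the claim is the scalar
inequality `hr`. -/
theorem posSemidef_quadratic_sub_exp {A : Matrix m m ℝ} (hA : A.IsHermitian) {r κ : ℝ}
    (hr : ∀ x ≤ r, Real.exp x ≤ 1 + x + κ * x ^ 2)
    (h : ∀ v : m → ℝ, v ⬝ᵥ A *ᵥ v ≤ r * (v ⬝ᵥ v)) :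
    (1 + A + κ • (A * A) - NormedSpace.exp A).PosSemidef := by
  obtain ⟨U, h1, h1', e, e'⟩ := exists_diagonalization hA
  have key : 1 + A + κ • (A * A) - NormedSpace.exp A = U * diagonal (fun i =>
      1 + hA.eigenvalues i + κ * (hA.eigenvalues i) ^ 2 - Real.exp (hA.eigenvalues i)) * Uᴴ := by
    have ed : diagonal (fun i =>
      1 + hA.eigenvalues i + κ * (hA.eigenvalues i) ^ 2 - Real.exp (hA.eigenvalues i))
      = 1 + diagonal hA.eigenvalues + κ • (diagonal hA.eigenvalues * diagonal hA.eigenvalues)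
        - diagonal (fun i => Real.exp (hA.eigenvalues i)) := by
      rw [diagonal_mul_diagonal, ← diagonal_one, ← diagonal_smul, diagonal_add, diagonal_add,
        diagonal_sub]
      congr 1; ext i; simp [pow_two]
    rw [ed, e']
    generalize (diagonal fun i => Real.exp (hA.eigenvalues i)) = E
    generalize diagonal hA.eigenvalues = D at e
    have eA2 : A * A = U * (D * D) * Uᴴ := by
      rw [e]
      calc U * D * Uᴴ * (U * D * Uᴴ) = U * D * (Uᴴ * U) * D * Uᴴ := by
            simp only [Matrix.mul_assoc]
        _ = _ := by rw [h1]; simp only [Matrix.mul_assoc, Matrix.one_mul]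
    rw [eA2, e]
    simp only [Matrix.mul_add, Matrix.add_mul, Matrix.mul_sub, Matrix.sub_mul, Matrix.mul_one, h1',
      Matrix.mul_smul, Matrix.smul_mul]
  rw [key]
  refine (PosSemidef.diagonal fun i => ?_).mul_mul_conjTranspose_same U
  have := hr _ (eigenvalue_le_of_form_le hA h i)
  simpa using this

theorem posSemidef_exp {A : Matrix m m ℝ} (hA : A.IsHermitian) :
    (NormedSpace.exp A).PosSemidef := by
  obtain ⟨U, -, -, -, e⟩ := exists_diagonalization hA
  rw [e]
  exact (PosSemidef.diagonal fun i => (Real.exp_pos _).le).mul_mul_conjTranspose_same _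

theorem exists_exp_sub_sub_one_eq {A : Matrix m m ℝ} (hA : A.IsHermitian) :
    ∃ U : Matrix m m ℝ, Uᴴ * U = 1 ∧ NormedSpace.exp A - A - 1 = U * diagonal
      (fun i => Real.exp (hA.eigenvalues i) - hA.eigenvalues i - 1) * Uᴴ := by
  obtain ⟨U, h1, h1', e, e'⟩ := exists_diagonalization hA
  refine ⟨U, h1, ?_⟩
  have ed : diagonal (fun i => Real.exp (hA.eigenvalues i) - hA.eigenvalues i - 1)
      = diagonal (fun i => Real.exp (hA.eigenvalues i)) - diagonal hA.eigenvalues - 1 := by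
    rw [← diagonal_one, diagonal_sub, diagonal_sub]
  rw [ed, e']
  generalize (diagonal fun i => Real.exp (hA.eigenvalues i)) = E
  generalize diagonal hA.eigenvalues = D at e
  rw [e]
  simp only [Matrix.mul_sub, Matrix.sub_mul, Matrix.mul_one, h1']

theorem posSemidef_exp_sub {A : Matrix m m ℝ} (hA : A.IsHermitian) :
    (NormedSpace.exp A - A - 1).PosSemidef := by
  obtain ⟨U, -, e⟩ := exists_exp_sub_sub_one_eq hA
  rw [e]
  refine (PosSemidef.diagonal fun i => ?_).mul_mul_conjTranspose_same _
  have := Real.add_one_le_exp (hA.eigenvalues i)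
  simp only [Pi.zero_apply]; linarith

/-- A direction in which a symmetric matrix exceeds `L` makes the trace of `exp A - A - 1` large. -/
theorem exp_sub_sub_one_le_trace {A : Matrix m m ℝ} (hA : A.IsHermitian) {L : ℝ} (hL : 0 ≤ L)
    {u : m → ℝ} (hu : L * (u ⬝ᵥ u) < u ⬝ᵥ A *ᵥ u) :
    Real.exp L - L - 1 ≤ (NormedSpace.exp A - A - 1).trace := by
  -- Otherwise `L - A` would be positive semidefinite, against the direction `u`.
  have hi : ∃ i, L ≤ hA.eigenvalues i := by
    by_contra! hcon
    have hps : (L • (1 : Matrix m m ℝ) - A).PosSemidef := by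
      obtain ⟨U, h1, h1', e, -⟩ := exists_diagonalization hA
      have : L • (1 : Matrix m m ℝ) - A = U * diagonal (fun i => L - hA.eigenvalues i) * Uᴴ := by
        have ed : diagonal (fun i => L - hA.eigenvalues i)
            = L • (1 : Matrix m m ℝ) - diagonal hA.eigenvalues := by
          rw [← diagonal_one, ← diagonal_smul, diagonal_sub]
          congr 1; ext i; simp
        rw [ed]
        generalize diagonal hA.eigenvalues = D at e
        rw [e]
        simp only [Matrix.mul_sub, Matrix.sub_mul, Matrix.mul_smul, Matrix.smul_mul,
          Matrix.mul_one, h1']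
      rw [this]
      exact (PosSemidef.diagonal fun i => by simpa using (hcon i).le).mul_mul_conjTranspose_same U
    have := hps.dotProduct_mulVec_nonneg u
    simp only [star_trivial, sub_mulVec, smul_mulVec, one_mulVec, dotProduct_sub,
      dotProduct_smul, smul_eq_mul] at this
    linarith
  obtain ⟨i, hi⟩ := hi
  obtain ⟨U, h1, e⟩ := exists_exp_sub_sub_one_eq hA
  rw [e, trace_mul_comm, ← Matrix.mul_assoc, h1, Matrix.one_mul, trace_diagonal]
  have hmono : Real.exp L - L - 1 ≤ Real.exp (hA.eigenvalues i) - hA.eigenvalues i - 1 := by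
    have h2 := Real.add_one_le_exp (hA.eigenvalues i - L)
    have h3 := Real.one_le_exp hL
    have h4 : Real.exp (hA.eigenvalues i) = Real.exp L * Real.exp (hA.eigenvalues i - L) := by
      rw [← Real.exp_add]; congr 1; ring
    nlinarith
  -- Since `exp t - t - 1` is nonnegative for every real `t`, the other eigenvalues can be dropped.
  refine hmono.trans (Finset.single_le_sum (f := fun i => Real.exp (hA.eigenvalues i)
    - hA.eigenvalues i - 1) (fun j _ => ?_) (Finset.mem_univ i))
  have := Real.add_one_le_exp (hA.eigenvalues j)
  linarith

end Matrix

/-! ### Matrix Bernstein inequality with intrinsic dimension -/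

section RandomMatrix

open Matrix

variable {m : Type*} [Fintype m] [DecidableEq m]

theorem continuous_matrix_exp : Continuous (NormedSpace.exp : Matrix m m ℝ → Matrix m m ℝ) := by
  let _ : NormedRing (Matrix m m ℝ) := Matrix.linftyOpNormedRing
  let _ : NormedAlgebra ℝ (Matrix m m ℝ) := Matrix.linftyOpNormedAlgebra
  let _ : NormedAlgebra ℚ (Matrix m m ℝ) := NormedAlgebra.restrictScalars ℚ ℝ _
  exact NormedSpace.exp_continuous

theorem continuous_trace_exp_sub :
    Continuous fun M : Matrix m m ℝ => (NormedSpace.exp M - M - 1).trace :=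
  ((continuous_matrix_exp.sub continuous_id).sub continuous_const).matrix_trace

omit [Fintype m] [DecidableEq m] in
theorem measurable_comp_matrix [Finite m] {X : Type*} [MeasurableSpace X] {f : Matrix m m ℝ → ℝ}
    (hf : Continuous f) {M : X → Matrix m m ℝ} (hM : ∀ i j, Measurable fun x => M x i j) :
    Measurable fun x => f (M x) := by
  have hf' : Continuous fun g : m → m → ℝ => f (Matrix.of g) := hf
  exact hf'.measurable.comp (measurable_pi_iff.2 fun i => measurable_pi_iff.2 fun j => hM i j)

-- The entries stay in a compact cube, on which a continuous function is bounded.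
omit [Fintype m] [DecidableEq m] in
theorem integrable_comp_matrix [Finite m] {X : Type*} [MeasurableSpace X] {μ : Measure X}
    [IsFiniteMeasure μ] {f : Matrix m m ℝ → ℝ} (hf : Continuous f) {M : X → Matrix m m ℝ}
    (hM : ∀ i j, Measurable fun x => M x i j) {R : ℝ} (hR : ∀ x i j, |M x i j| ≤ R) :
    Integrable (fun x => f (M x)) μ := by
  have hf' : Continuous fun g : m → m → ℝ => f (Matrix.of g) := hf
  have hK : IsCompact (Set.univ.pi fun _ : m => Set.univ.pi fun _ : m => Set.Icc (-R) R) :=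
    isCompact_univ_pi fun _ => isCompact_univ_pi fun _ => isCompact_Icc
  obtain ⟨C, hC⟩ := hK.exists_bound_of_continuousOn hf'.continuousOn
  refine Integrable.of_bound (measurable_comp_matrix hf hM).aestronglyMeasurable C
    (Filter.Eventually.of_forall fun x => hC (fun i j => M x i j)
      (Set.mem_univ_pi.2 fun i => Set.mem_univ_pi.2 fun j => abs_le.1 (hR x i j)))

/-- The scaled deviation `θ (C - v vᵀ)` of a rank one matrix from the diagonal matrix `C`. -/
noncomputable def deviation (c : m → ℝ) (θ : ℝ) (v : m → ℝ) : Matrix m m ℝ :=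
  θ • (diagonal c - vecMulVec v v)

omit [Fintype m] in
theorem deviation_isHermitian (c : m → ℝ) (θ : ℝ) (v : m → ℝ) :
    (deviation c θ v).IsHermitian := by
  ext i j
  simp [deviation, vecMulVec_apply, diagonal_apply, mul_comm (v i), eq_comm (a := i)]
  grind

omit [Fintype m] in
theorem deviation_sum_isHermitian {κ : Type*} (t : Finset κ) (c : m → ℝ) (θ : ℝ) (v : κ → m → ℝ) :
    (∑ k ∈ t, deviation c θ (v k)).IsHermitian := by
  classical
  induction t using Finset.induction_on with
  | empty => simp
  | insert k t hk ih =>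
    rw [Finset.sum_insert hk]
    exact (deviation_isHermitian c θ (v k)).add ih

omit [Fintype m] in
theorem measurable_deviation_apply {X : Type*} [MeasurableSpace X] (c : m → ℝ) (θ : ℝ)
    {a : X → m → ℝ} (ha : ∀ i, Measurable fun x => a x i) (i j : m) :
    Measurable fun x => deviation c θ (a x) i j := by
  simp only [deviation, Matrix.smul_apply, Matrix.sub_apply, vecMulVec_apply, smul_eq_mul]
  exact (measurable_const.sub ((ha i).mul (ha j))).const_mul θ

omit [DecidableEq m] in
theorem abs_mul_le_of_dotProduct_le {v : m → ℝ} {D : ℝ} (hv : v ⬝ᵥ v ≤ D) (i j : m) :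
    |v i * v j| ≤ D := by
  have h : ∀ k, v k * v k ≤ D := fun k =>
    (Finset.single_le_sum (f := fun k => v k * v k) (fun k _ => mul_self_nonneg _)
      (Finset.mem_univ k)).trans hv
  rw [abs_le]
  constructor <;> nlinarith [h i, h j, sq_nonneg (v i + v j), sq_nonneg (v i - v j)]

theorem abs_deviation_apply_le {c : m → ℝ} (hc0 : ∀ i, 0 ≤ c i) (hc1 : ∀ i, c i ≤ 1) {θ : ℝ}
    (hθ : 0 ≤ θ) {v : m → ℝ} {D : ℝ} (hv : v ⬝ᵥ v ≤ D) (i j : m) :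
    |deviation c θ v i j| ≤ θ * (1 + D) := by
  simp only [deviation, Matrix.smul_apply, Matrix.sub_apply, vecMulVec_apply, smul_eq_mul]
  rw [abs_mul, abs_of_nonneg hθ]
  gcongr
  refine (abs_sub _ _).trans (add_le_add ?_ (abs_mul_le_of_dotProduct_le hv i j))
  rw [diagonal_apply]
  split_ifs
  · rw [abs_of_nonneg (hc0 i)]; exact hc1 i
  · simp

/-- The rank one term only lowers the form, so the bound is independent of the size of `v`. This
one-sidedness is why the scalar bound on `exp t` is required only for `t ≤ θ`. -/
theorem deviation_form_le {c : m → ℝ} (hc1 : ∀ i, c i ≤ 1) {θ : ℝ} (hθ : 0 ≤ θ) (v u : m → ℝ) :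
    u ⬝ᵥ deviation c θ v *ᵥ u ≤ θ * (u ⬝ᵥ u) := by
  have h0 : u ⬝ᵥ deviation c θ v *ᵥ u
      = θ * (u ⬝ᵥ (diagonal c *ᵥ u) - u ⬝ᵥ (MulOpposite.op (v ⬝ᵥ u) • v)) := by
    rw [deviation, smul_mulVec, sub_mulVec, dotProduct_smul, dotProduct_sub, smul_eq_mul,
      vecMulVec_mulVec]
  rw [h0]
  gcongr
  have h1 : u ⬝ᵥ (fun i => c i * u i) ≤ u ⬝ᵥ u := by
    refine Finset.sum_le_sum fun i _ => ?_
    nlinarith [mul_nonneg (sub_nonneg.2 (hc1 i)) (mul_self_nonneg (u i))]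
  have h2 : 0 ≤ u ⬝ᵥ (MulOpposite.op (v ⬝ᵥ u) • v) := by
    simp only [op_smul_eq_smul, dotProduct_smul, smul_eq_mul, dotProduct_comm u v]
    exact mul_self_nonneg _
  have h3 : diagonal c *ᵥ u = fun i => c i * u i := by ext i; simp [mulVec_diagonal]
  rw [h3]
  linarith

variable {S : Type*} [MeasurableSpace S] {ρ : Measure S} [IsProbabilityMeasure ρ]

theorem integral_trace_mul_deviation {a : S → m → ℝ} (ha : ∀ i, Measurable fun x => a x i) {D : ℝ}
    (hD : ∀ x, a x ⬝ᵥ a x ≤ D) {c : m → ℝ}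
    (hcov : ∀ i j, ∫ x, a x i * a x j ∂ρ = diagonal c i j) (θ : ℝ) (W : Matrix m m ℝ) :
    ∫ x, (W * deviation c θ (a x)).trace ∂ρ = 0 := by
  have hint : ∀ i j, Integrable (fun x => a x i * a x j) ρ := fun i j =>
    Integrable.of_bound ((ha i).mul (ha j)).aestronglyMeasurable D
      (Filter.Eventually.of_forall fun x => abs_mul_le_of_dotProduct_le (hD x) i j)
  simp only [Matrix.trace, diag_apply, mul_apply, deviation, Matrix.smul_apply, Matrix.sub_apply,
    vecMulVec_apply, smul_eq_mul]
  rw [integral_finsetSum]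
  · refine Finset.sum_eq_zero fun i _ => ?_
    rw [integral_finsetSum]
    · refine Finset.sum_eq_zero fun j _ => ?_
      rw [integral_const_mul, integral_const_mul, integral_sub (integrable_const _) (hint j i),
        hcov]
      simp
    · exact fun j _ => (((integrable_const _).sub (hint j i)).const_mul θ).const_mul _
  · exact fun i _ => integrable_finsetSum _ fun j _ =>
      (((integrable_const _).sub (hint j i)).const_mul θ).const_mul _

/-- With `Y = v vᵀ` one has `Y² = |v|² Y`, which costs at most `D Y` against `W ≥ 0`. As `Y` has
mean `C`, the mean of `(C - Y)²` is thus at most `D C - C²`, and `C²` is discarded. -/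
theorem integral_trace_mul_deviation_sq_le {a : S → m → ℝ} (ha : ∀ i, Measurable fun x => a x i)
    {D : ℝ} (hD : ∀ x, a x ⬝ᵥ a x ≤ D) {c : m → ℝ} (hc0 : ∀ i, 0 ≤ c i) (hc1 : ∀ i, c i ≤ 1)
    (hcov : ∀ i j, ∫ x, a x i * a x j ∂ρ = diagonal c i j) {θ : ℝ} (hθ : 0 ≤ θ) {W : Matrix m m ℝ}
    (hW : W.PosSemidef) :
    ∫ x, (W * (deviation c θ (a x) * deviation c θ (a x))).trace ∂ρ
      ≤ θ ^ 2 * D * (W * diagonal c).trace := by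
  have hint : ∀ i j, Integrable (fun x => a x i * a x j) ρ := fun i j =>
    Integrable.of_bound ((ha i).mul (ha j)).aestronglyMeasurable D
      (Filter.Eventually.of_forall fun x => abs_mul_le_of_dotProduct_le (hD x) i j)
  have hlin : ∀ B : Matrix m m ℝ, Integrable (fun x => (B * vecMulVec (a x) (a x)).trace) ρ ∧
      ∫ x, (B * vecMulVec (a x) (a x)).trace ∂ρ = (B * diagonal c).trace := by
    intro B
    simp only [Matrix.trace, diag_apply, mul_apply, vecMulVec_apply]
    refine ⟨integrable_finsetSum _ fun i _ => integrable_finsetSum _ fun j _ =>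
      (hint j i).const_mul _, ?_⟩
    rw [integral_finsetSum]
    · refine Finset.sum_congr rfl fun i _ => ?_
      rw [integral_finsetSum]
      · exact Finset.sum_congr rfl fun j _ => by rw [integral_const_mul, hcov]
      · exact fun j _ => (hint j i).const_mul _
    · exact fun i _ => integrable_finsetSum _ fun j _ => (hint j i).const_mul _
  set C := diagonal c with hC
  have hpt : ∀ x, (W * (deviation c θ (a x) * deviation c θ (a x))).trace ≤
      θ ^ 2 * ((W * (C * C)).trace - ((W * C) * vecMulVec (a x) (a x)).trace
        - ((C * W) * vecMulVec (a x) (a x)).trace + D * (W * vecMulVec (a x) (a x)).trace) := by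
    intro x
    set Y := vecMulVec (a x) (a x) with hY
    have hYY : Y * Y = (a x ⬝ᵥ a x) • Y := by
      ext i j
      simp only [hY, mul_apply, vecMulVec_apply, Matrix.smul_apply, smul_eq_mul, dotProduct,
        Finset.sum_mul]
      exact Finset.sum_congr rfl fun k _ => by ring
    have hYp : Y.PosSemidef := by
      simpa using posSemidef_vecMulVec_self_star (a x)
    have h0 : 0 ≤ (W * Y).trace := trace_mul_nonneg hW hYp
    have e1 : W * (deviation c θ (a x) * deviation c θ (a x)) =
        θ ^ 2 • (W * (C * C) - W * C * Y - W * (Y * C) + (a x ⬝ᵥ a x) • (W * Y)) := by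
      have : W * (deviation c θ (a x) * deviation c θ (a x)) =
        θ ^ 2 • (W * (C * C) - W * C * Y - W * (Y * C) + W * (Y * Y)) := by
        have hZ : W * ((C - Y) * (C - Y)) = W * (C * C) - W * C * Y - W * (Y * C) + W * (Y * Y) := by
          noncomm_ring
        rw [deviation, ← hC, ← hY, Matrix.smul_mul, Matrix.mul_smul, Matrix.mul_smul,
          Matrix.mul_smul, smul_smul, ← pow_two, hZ]
      rw [this, hYY, Matrix.mul_smul]
    have e2 : (W * (Y * C)).trace = (C * W * Y).trace := by
      rw [← Matrix.mul_assoc, trace_mul_comm, Matrix.mul_assoc]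
    rw [e1, trace_smul, trace_add, trace_sub, trace_sub, e2, trace_smul, smul_eq_mul, smul_eq_mul]
    gcongr
    exact hD x
  have hi : Integrable (fun x => θ ^ 2 * ((W * (C * C)).trace
      - ((W * C) * vecMulVec (a x) (a x)).trace - ((C * W) * vecMulVec (a x) (a x)).trace
      + D * (W * vecMulVec (a x) (a x)).trace)) ρ :=
    ((((integrable_const _).sub (hlin _).1).sub (hlin _).1).add
      ((hlin _).1.const_mul _)).const_mul _
  have hL : Integrable (fun x => (W * (deviation c θ (a x) * deviation c θ (a x))).trace) ρ :=
    integrable_comp_matrix (f := fun M => (W * (M * M)).trace)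
      (continuous_const.matrix_mul (continuous_id.matrix_mul continuous_id)).matrix_trace
      (measurable_deviation_apply c θ ha) (fun x => abs_deviation_apply_le hc0 hc1 hθ (hD x))
  refine (integral_mono hL hi hpt).trans ?_
  have hsum : ∀ (k : ℝ) (f g h : S → ℝ), Integrable f ρ → Integrable g ρ → Integrable h ρ →
      ∫ x, (k - f x - g x + D * h x) ∂ρ
        = k - ∫ x, f x ∂ρ - ∫ x, g x ∂ρ + D * ∫ x, h x ∂ρ := by
    intro k f g h hf hg hh
    have h1 : Integrable (fun x => k - f x) ρ := (integrable_const k).sub hf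
    have h2 : Integrable (fun x => k - f x - g x) ρ := h1.sub hg
    rw [integral_add h2 (hh.const_mul D), integral_sub h1 hg, integral_sub (integrable_const k) hf,
      integral_const_mul]
    simp
  rw [integral_const_mul, hsum _ _ _ _ (hlin _).1 (hlin _).1 (hlin _).1, (hlin _).2, (hlin _).2,
    (hlin _).2]
  have hCC : 0 ≤ (W * (C * C)).trace := by
    refine trace_mul_nonneg hW ?_
    rw [hC, diagonal_mul_diagonal]
    exact PosSemidef.diagonal fun i => mul_self_nonneg _
  have e3 : (C * W * C).trace = (W * (C * C)).trace := by
    rw [Matrix.mul_assoc, trace_mul_comm, Matrix.mul_assoc]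
  rw [e3, Matrix.mul_assoc]
  have := mul_nonneg (sq_nonneg θ) hCC
  linarith

/-- One induction step: Golden–Thompson separates the new summand from the fixed `B`, the quadratic
bound replaces its exponential, its mean vanishes, and its second moment is controlled by `C`. -/
theorem integral_trace_exp_step_le {a : S → m → ℝ} (ha : ∀ i, Measurable fun x => a x i)
    {D : ℝ} (hD : ∀ x, a x ⬝ᵥ a x ≤ D) {c : m → ℝ} (hc0 : ∀ i, 0 ≤ c i) (hc1 : ∀ i, c i ≤ 1)
    (hcD : ∑ i, c i ≤ D) (hcov : ∀ i j, ∫ x, a x i * a x j ∂ρ = diagonal c i j) {θ κ : ℝ}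
    (hθ : 0 ≤ θ) (hκ : 0 ≤ κ) (hexp : ∀ t ≤ θ, Real.exp t ≤ 1 + t + κ * t ^ 2)
    {B : Matrix m m ℝ} (hB : B.IsHermitian) :
    ∫ x, (NormedSpace.exp (deviation c θ (a x) + B) - (deviation c θ (a x) + B) - 1).trace ∂ρ
      ≤ (NormedSpace.exp B - B - 1).trace
        + κ * θ ^ 2 * D * ((NormedSpace.exp B - B - 1).trace + (B * diagonal c).trace + D) := by
  have hW := posSemidef_exp hB
  have hWB := posSemidef_exp_sub hB
  set W := NormedSpace.exp B with hWdef
  have hm := measurable_deviation_apply c θ ha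
  have hbd := fun x => abs_deviation_apply_le hc0 hc1 hθ (hD x)
  have hI1 : Integrable (fun x => (NormedSpace.exp (deviation c θ (a x) + B)
      - (deviation c θ (a x) + B) - 1).trace) ρ :=
    integrable_comp_matrix (f := fun M => (NormedSpace.exp (M + B) - (M + B) - 1).trace)
      (continuous_trace_exp_sub.comp (continuous_id.add continuous_const)) hm hbd
  have hI2 : ∀ V : Matrix m m ℝ, Integrable (fun x => (V * deviation c θ (a x)).trace) ρ := fun V =>
    integrable_comp_matrix (f := fun M => (V * M).trace)
      (continuous_const.matrix_mul continuous_id).matrix_trace hm hbd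
  have hI3 : Integrable (fun x => (W * (deviation c θ (a x) * deviation c θ (a x))).trace) ρ :=
    integrable_comp_matrix (f := fun M => (W * (M * M)).trace)
      (continuous_const.matrix_mul (continuous_id.matrix_mul continuous_id)).matrix_trace hm hbd
  have hpt : ∀ x, (NormedSpace.exp (deviation c θ (a x) + B)
      - (deviation c θ (a x) + B) - 1).trace ≤ ((W - B - 1).trace
        + (W * deviation c θ (a x)).trace - (1 * deviation c θ (a x)).trace)
        + κ * (W * (deviation c θ (a x) * deviation c θ (a x))).trace := by
    intro x
    have hX := deviation_isHermitian c θ (a x)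
    have hform := deviation_form_le hc1 hθ (a x)
    generalize deviation c θ (a x) = X at hX hform
    have h1 := trace_exp_add_le (A := X) (B := B) (by simpa using hX.eq) (by simpa using hB.eq)
    have h2 := trace_mul_nonneg hW (posSemidef_quadratic_sub_exp hX hexp hform)
    rw [trace_mul_comm, ← hWdef] at h1
    simp only [Matrix.mul_sub, Matrix.mul_add, trace_sub, trace_add, Matrix.mul_smul, trace_smul,
      smul_eq_mul, Matrix.mul_one] at h2
    simp only [trace_sub, trace_add, Matrix.one_mul]
    linarith
  have h1 : Integrable (fun x => (W - B - 1).trace + (W * deviation c θ (a x)).trace) ρ :=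
    (integrable_const _).add (hI2 W)
  have h2 : Integrable (fun x => (W - B - 1).trace + (W * deviation c θ (a x)).trace
      - (1 * deviation c θ (a x)).trace) ρ := h1.sub (hI2 1)
  refine (integral_mono hI1 (h2.add (hI3.const_mul κ)) hpt).trans ?_
  simp only [Pi.add_apply]
  rw [integral_add h2 (hI3.const_mul κ), integral_sub h1 (hI2 1),
    integral_add (integrable_const _) (hI2 W), integral_trace_mul_deviation ha hD hcov,
    integral_trace_mul_deviation ha hD hcov, integral_const_mul]
  simp only [integral_const, probReal_univ, smul_eq_mul, one_mul, add_zero, sub_zero]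
  have h3 := integral_trace_mul_deviation_sq_le ha hD hc0 hc1 hcov hθ hW
  -- Splitting `W = (W - B - 1) + B + 1` lets `C ≤ 1` act on the positive part only; the identity
  -- contributes `tr C ≤ D` instead of the dimension.
  have h4 : (W * diagonal c).trace ≤ (W - B - 1).trace + (B * diagonal c).trace + D := by
    have h5 : 0 ≤ ((W - B - 1) * (1 - diagonal c)).trace := by
      refine trace_mul_nonneg hWB ?_
      rw [← diagonal_one, diagonal_sub]
      exact PosSemidef.diagonal fun i => by simpa using hc1 i
    have h6 : (diagonal c).trace ≤ D := by rwa [trace_diagonal]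
    simp only [Matrix.sub_mul, Matrix.mul_sub, trace_sub, Matrix.mul_one, Matrix.one_mul] at h5 ⊢
    linarith
  have h0D : 0 ≤ D := (Finset.sum_nonneg fun i _ => hc0 i).trans hcD
  have h7 := mul_le_mul_of_nonneg_left h3 hκ
  have h8 := mul_le_mul_of_nonneg_left h4 (by positivity : 0 ≤ κ * (θ ^ 2 * D))
  calc _ ≤ (W - B - 1).trace + κ * (θ ^ 2 * D * (W * diagonal c).trace) := by gcongr
    _ ≤ _ := by linarith

/-- The trace moment bound behind the matrix Bernstein inequality with intrinsic dimension. -/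
theorem integral_trace_exp_sum_le {a : S → m → ℝ} (ha : ∀ i, Measurable fun x => a x i)
    {D : ℝ} (hD : ∀ x, a x ⬝ᵥ a x ≤ D) {c : m → ℝ} (hc0 : ∀ i, 0 ≤ c i) (hc1 : ∀ i, c i ≤ 1)
    (hcD : ∑ i, c i ≤ D) (hcov : ∀ i j, ∫ x, a x i * a x j ∂ρ = diagonal c i j) {θ κ : ℝ}
    (hθ : 0 ≤ θ) (hκ : 0 ≤ κ) (hexp : ∀ t ≤ θ, Real.exp t ≤ 1 + t + κ * t ^ 2) (n : ℕ) :
    ∫ x : Fin n → S, (NormedSpace.exp (∑ k, deviation c θ (a (x k)))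
        - (∑ k, deviation c θ (a (x k))) - 1).trace ∂(Measure.pi fun _ => ρ)
      ≤ D * ((1 + κ * θ ^ 2 * D) ^ n - 1) ∧
    ∀ V : Matrix m m ℝ, ∫ x : Fin n → S, ((∑ k, deviation c θ (a (x k))) * V).trace
      ∂(Measure.pi fun _ => ρ) = 0 := by
  have h0D : 0 ≤ D := (Finset.sum_nonneg fun i _ => hc0 i).trans hcD
  have hm : ∀ k i j, Measurable fun x : Fin k → S => (∑ l, deviation c θ (a (x l))) i j := by
    intro k i j
    simp only [Matrix.sum_apply]
    exact Finset.measurable_sum _ fun l _ =>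
      (measurable_deviation_apply c θ ha i j).comp (measurable_pi_apply l)
  have hbd : ∀ k (x : Fin k → S) i j, |(∑ l, deviation c θ (a (x l))) i j|
      ≤ k * (θ * (1 + D)) := by
    intro k x i j
    rw [Matrix.sum_apply]
    refine (Finset.abs_sum_le_sum_abs _ _).trans ((Finset.sum_le_sum fun l _ =>
      abs_deviation_apply_le hc0 hc1 hθ (hD (x l)) i j).trans ?_)
    simp
  have hI : ∀ k {f : Matrix m m ℝ → ℝ}, Continuous f →
      Integrable (fun x : Fin k → S => f (∑ l, deviation c θ (a (x l))))
        (Measure.pi fun _ => ρ) := fun k f hf => integrable_comp_matrix hf (hm k) (hbd k)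
  -- Fubini, integrating out coordinate `0` first.
  have hsplit : ∀ k {f : Matrix m m ℝ → ℝ}, Continuous f →
      ∫ x : Fin (k + 1) → S, f (∑ l, deviation c θ (a (x l))) ∂(Measure.pi fun _ => ρ)
        = ∫ y : Fin k → S, ∫ x, f (deviation c θ (a x) + ∑ l, deviation c θ (a (y l))) ∂ρ
          ∂(Measure.pi fun _ => ρ) ∧
      Integrable (fun y : Fin k → S => ∫ x, f (deviation c θ (a x)
        + ∑ l, deviation c θ (a (y l))) ∂ρ) (Measure.pi fun _ => ρ) := by
    intro k f hf
    have hmp := measurePreserving_piFinSuccAbove (fun _ : Fin (k + 1) => ρ) 0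
    set g : S × (Fin k → S) → ℝ := fun z => f (deviation c θ (a z.1)
      + ∑ l, deviation c θ (a (z.2 l))) with hg
    have hgi : Integrable g (ρ.prod (Measure.pi fun _ => ρ)) := by
      refine integrable_comp_matrix hf (fun i j => ?_) (R := θ * (1 + D) + k * (θ * (1 + D)))
        fun z i j => ?_
      · exact ((measurable_deviation_apply c θ ha i j).comp measurable_fst).add
          ((hm k i j).comp measurable_snd)
      · exact (abs_add_le _ _).trans (add_le_add (abs_deviation_apply_le hc0 hc1 hθ (hD _) i j)
          (hbd k z.2 i j))
    refine ⟨?_, hgi.integral_prod_right⟩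
    rw [← integral_prod_symm g hgi]
    rw [← hmp.integral_comp' g]
    refine integral_congr_ae (Filter.Eventually.of_forall fun x => ?_)
    simp only [hg, Fin.sum_univ_succ]
    rfl
  -- The second claim removes the mean of `tr (B C)` left by the one-step bound. With `v = κ θ² D`
  -- the moments obey `F (n+1) ≤ F n + v (F n + D)`, so `F n + D ≤ D (1 + v) ^ n`.
  induction n with
  | zero =>
    refine ⟨?_, fun V => by simp⟩
    simp
  | succ n ih =>
    obtain ⟨ih1, ih2⟩ := ih
    constructor
    · obtain ⟨e, hi⟩ := hsplit n (continuous_trace_exp_sub (m := m))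
      rw [e]
      have hI1 := hI n (continuous_trace_exp_sub (m := m))
      have hI2 := hI n (f := fun M => (M * diagonal c).trace)
        (continuous_id.matrix_mul continuous_const).matrix_trace
      refine (integral_mono hi (hI1.add (((hI1.add hI2).add (integrable_const D)).const_mul
        (κ * θ ^ 2 * D))) fun y => integral_trace_exp_step_le ha hD hc0 hc1 hcD hcov hθ hκ hexp
          (deviation_sum_isHermitian _ _ _ _)).trans ?_
      have h1 : ∀ f g : (Fin n → S) → ℝ, Integrable f (Measure.pi fun _ => ρ) →
          Integrable g (Measure.pi fun _ => ρ) → ∀ v : ℝ,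
          ∫ y, (f + fun y => v * (f y + g y + D)) y ∂(Measure.pi fun _ => ρ)
            = ∫ y, f y ∂(Measure.pi fun _ => ρ) + v * (∫ y, f y ∂(Measure.pi fun _ => ρ)
              + ∫ y, g y ∂(Measure.pi fun _ => ρ) + D) := by
        intro f g hf hg v
        simp only [Pi.add_apply]
        have hfg : Integrable (fun y => f y + g y) (Measure.pi fun _ : Fin n => ρ) := hf.add hg
        have hfgD : Integrable (fun y => f y + g y + D) (Measure.pi fun _ : Fin n => ρ) :=
          hfg.add (integrable_const D)
        rw [integral_add hf (hfgD.const_mul v), integral_const_mul,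
          integral_add hfg (integrable_const D), integral_add hf hg]
        simp
      refine (h1 _ _ hI1 hI2 _).trans_le ?_
      rw [ih2]
      have hv : 0 ≤ κ * θ ^ 2 * D := by positivity
      nlinarith [mul_le_mul_of_nonneg_left ih1 hv, pow_succ (1 + κ * θ ^ 2 * D) n]
    · intro V
      obtain ⟨e, hi⟩ := hsplit n (f := fun M => (M * V).trace)
        (continuous_id.matrix_mul continuous_const).matrix_trace
      rw [e]
      rw [← ih2 V]
      refine integral_congr_ae (Filter.Eventually.of_forall fun y => ?_)
      simp only [Matrix.add_mul, trace_add]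
      have h1 : Integrable (fun x => (deviation c θ (a x) * V).trace) ρ :=
        integrable_comp_matrix (f := fun M => (M * V).trace)
          (continuous_id.matrix_mul continuous_const).matrix_trace
          (measurable_deviation_apply c θ ha)
          (fun x => abs_deviation_apply_le hc0 hc1 hθ (hD x))
      rw [integral_add h1 (integrable_const _)]
      simp_rw [trace_mul_comm _ V]
      rw [integral_trace_mul_deviation ha hD hcov]
      simp

/-- A one-sided matrix Bernstein inequality with intrinsic dimension for sums of independent
rank one matrices. -/
theorem measure_exists_lt_form_le {a : S → m → ℝ} (ha : ∀ i, Measurable fun x => a x i)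
    {D : ℝ} (hD : ∀ x, a x ⬝ᵥ a x ≤ D) {c : m → ℝ} (hc0 : ∀ i, 0 ≤ c i) (hc1 : ∀ i, c i ≤ 1)
    (hcD : ∑ i, c i ≤ D) (hcov : ∀ i j, ∫ x, a x i * a x j ∂ρ = diagonal c i j) {θ κ : ℝ}
    (hθ : 0 ≤ θ) (hκ : 0 ≤ κ) (hexp : ∀ t ≤ θ, Real.exp t ≤ 1 + t + κ * t ^ 2) (n : ℕ)
    {L : ℝ} (hL : 0 < L) {Ω : Type*} [MeasurableSpace Ω] {P : Measure Ω} [IsProbabilityMeasure P]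
    {X : Fin n → Ω → S} (hlaw : ∀ j, HasLaw (X j) ρ P) (hindep : iIndepFun X P) :
    P {ω | ∃ u : m → ℝ, L * (u ⬝ᵥ u) < u ⬝ᵥ (∑ k, deviation c θ (a (X k ω))) *ᵥ u}
      ≤ ENNReal.ofReal (D * (1 + κ * θ ^ 2 * D) ^ n / (Real.exp L - L - 1)) := by
  have h0D : 0 ≤ D := (Finset.sum_nonneg fun i _ => hc0 i).trans hcD
  set F : (Fin n → S) → ℝ := fun x => (NormedSpace.exp (∑ k, deviation c θ (a (x k)))
        - (∑ k, deviation c θ (a (x k))) - 1).trace with hF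
  have hm : ∀ i j, Measurable fun x : Fin n → S => (∑ l, deviation c θ (a (x l))) i j := by
    intro i j
    simp only [Matrix.sum_apply]
    exact Finset.measurable_sum _ fun l _ =>
      (measurable_deviation_apply c θ ha i j).comp (measurable_pi_apply l)
  have hbd : ∀ (x : Fin n → S) i j, |(∑ l, deviation c θ (a (x l))) i j|
      ≤ n * (θ * (1 + D)) := by
    intro x i j
    rw [Matrix.sum_apply]
    refine (Finset.abs_sum_le_sum_abs _ _).trans ((Finset.sum_le_sum fun l _ =>
      abs_deviation_apply_le hc0 hc1 hθ (hD (x l)) i j).trans ?_)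
    simp
  have hFm : Measurable F := measurable_comp_matrix continuous_trace_exp_sub hm
  have hFi : Integrable F (Measure.pi fun _ => ρ) :=
    integrable_comp_matrix continuous_trace_exp_sub hm hbd
  have hF0 : ∀ x, 0 ≤ F x := fun x =>
    (posSemidef_exp_sub (deviation_sum_isHermitian _ _ _ _)).trace_nonneg
  have hpos : 0 < Real.exp L - L - 1 := by linarith [Real.add_one_lt_exp hL.ne']
  have hmap : P.map (fun ω j => X j ω) = Measure.pi fun _ => ρ := by
    rw [(iIndepFun_iff_map_fun_eq_pi_map fun j => (hlaw j).aemeasurable).1 hindep]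
    simp_rw [fun j => (hlaw j).map_eq]
  have hae : AEMeasurable (fun ω j => X j ω) P := aemeasurable_pi_iff.2 fun j => (hlaw j).aemeasurable
  -- Markov's inequality for `F`, after enlarging the event to a measurable one.
  calc P {ω | ∃ u : m → ℝ, L * (u ⬝ᵥ u) < u ⬝ᵥ (∑ k, deviation c θ (a (X k ω))) *ᵥ u}
      ≤ P ((fun ω j => X j ω) ⁻¹' {x | Real.exp L - L - 1 ≤ F x}) := by
        refine measure_mono fun ω ⟨u, hu⟩ => ?_
        exact exp_sub_sub_one_le_trace (deviation_sum_isHermitian _ _ _ _) hL.le hu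
    _ = (Measure.pi fun _ => ρ) {x | Real.exp L - L - 1 ≤ F x} := by
        rw [← hmap, Measure.map_apply_of_aemeasurable hae (measurableSet_le measurable_const hFm)]
    _ ≤ ENNReal.ofReal (D * (1 + κ * θ ^ 2 * D) ^ n / (Real.exp L - L - 1)) := by
        have h1 := mul_meas_ge_le_integral_of_nonneg (Filter.Eventually.of_forall hF0) hFi
          (Real.exp L - L - 1)
        have h2 := (integral_trace_exp_sum_le ha hD hc0 hc1 hcD hcov hθ hκ hexp n).1
        rw [ENNReal.le_ofReal_iff_toReal_le (measure_ne_top _ _) (by positivity), le_div_iff₀ hpos,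
          mul_comm]
        refine h1.trans (h2.trans ?_)
        linarith

end RandomMatrix

/-! ### The inclusion of the kernel space into L² and the interpolation error -/

section Embedding

open InnerProductSpace

variable {S : Type*} {H : Type*} [NormedAddCommGroup H] [InnerProductSpace ℝ H] [RKHS ℝ H S ℝ]
  [CompleteSpace H]

theorem inner_kerFun_one (x : S) (f : H) : inner ℝ (RKHS.kerFun H x (1 : ℝ)) f = f x := by
  rw [RKHS.kerFun_inner]; simp

theorem kern_eq_inner (x y : S) :
    kern H x y = inner ℝ (RKHS.kerFun H x (1 : ℝ)) (RKHS.kerFun H y (1 : ℝ)) := by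
  rw [inner_kerFun_one, RKHS.kerFun_apply]; rfl

theorem kern_comm (x y : S) : kern H x y = kern H y x := by
  rw [kern_eq_inner, kern_eq_inner, real_inner_comm]

theorem sq_apply_le (f : H) (x : S) : f x ^ 2 ≤ ‖f‖ ^ 2 * kern H x x := by
  rw [← inner_kerFun_one x f, kern_eq_inner, real_inner_self_eq_norm_sq, ← mul_pow, mul_comm ‖f‖]
  exact sq_le_sq' (neg_le_of_abs_le (abs_real_inner_le_norm _ _)) (real_inner_le_norm _ _)

variable [MeasurableSpace S]

/-- Kernel sections span a dense subspace, and norm convergence in `H` implies pointwise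
convergence. -/
theorem measurable_coe (hmeas : Measurable fun p : S × S => kern H p.1 p.2) (f : H) :
    Measurable (f : S → ℝ) := by
  have hspan : ∀ g ∈ Submodule.span ℝ {g : H | ∃ (x : S) (v : ℝ), RKHS.kerFun H x v = g},
      Measurable (g : S → ℝ) := by
    intro g hg
    induction hg using Submodule.span_induction with
    | mem g hg =>
      obtain ⟨x, v, rfl⟩ := hg
      have : ((RKHS.kerFun H x v : H) : S → ℝ) = fun y => v * kern H y x := by
        ext y
        have : RKHS.kerFun H x v = v • RKHS.kerFun H x (1 : ℝ) := by
          rw [← map_smul]; simp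
        rw [this, RKHS.coe_smul, Pi.smul_apply, RKHS.kerFun_apply]; rfl
      rw [this]
      exact (hmeas.comp (measurable_id.prodMk measurable_const)).const_mul v
    | zero => rw [RKHS.coe_zero]; exact measurable_const
    | add a b _ _ ha hb => rw [RKHS.coe_add]; exact ha.add hb
    | smul r a _ ha => rw [RKHS.coe_smul]; exact ha.const_smul r
  have hf : f ∈ closure (Submodule.span ℝ {g : H | ∃ (x : S) (v : ℝ), RKHS.kerFun H x v = g} : Set H) := by
    have := RKHS.kerFun_dense H
    rw [← Submodule.topologicalClosure_coe, this]
    trivial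
  obtain ⟨u, hu, hlim⟩ := mem_closure_iff_seq_limit.1 hf
  refine measurable_of_tendsto_metrizable (fun n => hspan _ (hu n)) (tendsto_pi_nhds.2 fun x => ?_)
  exact ((RKHS.continuous_eval (H := H) x).tendsto f).comp hlim

variable {ν : Measure S}

theorem memLp_coe (hmeas : Measurable fun p : S × S => kern H p.1 p.2)
    (htrace : Integrable (fun x => kern H x x) ν) (f : H) : MemLp (f : S → ℝ) 2 ν := by
  rw [memLp_two_iff_integrable_sq (measurable_coe hmeas f).aestronglyMeasurable]
  refine (htrace.const_mul (‖f‖ ^ 2)).mono' ((measurable_coe hmeas f).pow_const 2).aestronglyMeasurable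
    (Filter.Eventually.of_forall fun x => ?_)
  rw [Real.norm_of_nonneg (sq_nonneg _)]
  exact sq_apply_le f x

/-- The inclusion of a reproducing kernel Hilbert space with integrable kernel trace into `L²`. -/
noncomputable def toL2 (hmeas : Measurable fun p : S × S => kern H p.1 p.2)
    (htrace : Integrable (fun x => kern H x x) ν) : H →L[ℝ] Lp ℝ 2 ν :=
  LinearMap.mkContinuous
    { toFun := fun f => (memLp_coe hmeas htrace f).toLp f
      map_add' := fun f g => by
        rw [← MemLp.toLp_add]; congr 1; exact RKHS.coe_add f g
      map_smul' := fun r f => by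
        rw [RingHom.id_apply, ← MemLp.toLp_const_smul]; congr 1; exact RKHS.coe_smul f r }
    (Real.sqrt (∫ x, kern H x x ∂ν)) fun f => by
      have h1 : ‖(memLp_coe hmeas htrace f).toLp f‖ ^ 2 = ∫ x, f x ^ 2 ∂ν := by
        rw [← real_inner_self_eq_norm_sq, L2.inner_def]
        refine integral_congr_ae ?_
        filter_upwards [(memLp_coe hmeas htrace f).coeFn_toLp] with x hx
        rw [hx]; simp [pow_two]
      have h2 : ∫ x, f x ^ 2 ∂ν ≤ ‖f‖ ^ 2 * ∫ x, kern H x x ∂ν := by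
        rw [← integral_const_mul]
        exact integral_mono (memLp_coe hmeas htrace f).integrable_sq (htrace.const_mul _)
          (sq_apply_le f)
      have h3 : 0 ≤ ∫ x, kern H x x ∂ν := integral_nonneg fun x => by
        simp only [kern_eq_inner]; exact real_inner_self_nonneg
      refine le_of_sq_le_sq ?_ (by positivity)
      rw [mul_pow, Real.sq_sqrt h3]
      change ‖(memLp_coe hmeas htrace f).toLp f‖ ^ 2 ≤ _
      linarith

variable (hmeas : Measurable fun p : S × S => kern H p.1 p.2)
    (htrace : Integrable (fun x => kern H x x) ν)

theorem toL2_ae_eq (f : H) : toL2 hmeas htrace f =ᵐ[ν] f :=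
  MemLp.coeFn_toLp (memLp_coe hmeas htrace f)

theorem inner_toL2 (f : H) (g : Lp ℝ 2 ν) :
    inner ℝ (toL2 hmeas htrace f) g = ∫ x, f x * g x ∂ν := by
  rw [L2.inner_def]
  refine integral_congr_ae ?_
  filter_upwards [toL2_ae_eq hmeas htrace f] with x hx
  rw [hx]; simp [mul_comm]

/-- Pairing the adjoint with a kernel section evaluates it, so the identity holds at every point,
not merely almost everywhere. -/
theorem adjoint_toL2_apply (g : Lp ℝ 2 ν) (x : S) :
    (ContinuousLinearMap.adjoint (toL2 hmeas htrace) g) x = integralOp (kern H) ν g x := by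
  rw [← inner_kerFun_one, ContinuousLinearMap.adjoint_inner_right, inner_toL2, integralOp]
  refine integral_congr_ae (Filter.Eventually.of_forall fun y => ?_)
  simp only
  rw [mul_comm, kern_comm, kern_eq_inner, inner_kerFun_one]

variable {ι : Type*} {μ : ι → ℝ} {e : HilbertBasis ι ℝ (Lp ℝ 2 ν)}

theorem toL2_adjoint_eigen (heig : IsEigensystem (kern H) ν μ e) (i : ι) :
    toL2 hmeas htrace (ContinuousLinearMap.adjoint (toL2 hmeas htrace) (e i)) = μ i • e i := by
  refine Lp.ext ?_
  filter_upwards [toL2_ae_eq hmeas htrace (ContinuousLinearMap.adjoint (toL2 hmeas htrace) (e i)),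
    heig i, Lp.coeFn_smul (μ i) (e i)] with x h1 h2 h3
  rw [h1, h3, adjoint_toL2_apply, h2]; simp

theorem inner_adjoint_eigen [DecidableEq ι] (heig : IsEigensystem (kern H) ν μ e) (i j : ι) :
    inner ℝ (ContinuousLinearMap.adjoint (toL2 hmeas htrace) (e i))
      (ContinuousLinearMap.adjoint (toL2 hmeas htrace) (e j)) = if i = j then μ j else 0 := by
  rw [ContinuousLinearMap.adjoint_inner_left, toL2_adjoint_eigen _ _ heig, inner_smul_right,
    orthonormal_iff_ite.1 e.orthonormal]
  split_ifs <;> simp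

-- The eigenvalue is the squared norm of the adjoint applied to `e i`. If it vanished, `e i` would
-- be orthogonal to the dense image of `H`.
include hmeas htrace in
theorem eigenvalue_pos (hdense : DenseInL2 H ν) (heig : IsEigensystem (kern H) ν μ e) (i : ι) :
    0 < μ i := by
  classical
  have h1 := inner_adjoint_eigen hmeas htrace heig i i
  rw [if_pos rfl, real_inner_self_eq_norm_sq] at h1
  rw [← h1]
  have hne : ContinuousLinearMap.adjoint (toL2 hmeas htrace) (e i) ≠ 0 := by
    intro h0
    have hall : ∀ g : Lp ℝ 2 ν, inner ℝ (e i) g = 0 := by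
      have hcl : IsClosed {g : Lp ℝ 2 ν | inner ℝ (e i) g = 0} :=
        isClosed_eq (by fun_prop) continuous_const
      intro g
      refine hcl.closure_subset_iff.2 ?_ (hdense g)
      rintro g ⟨f, hf⟩
      have : g = toL2 hmeas htrace f := Lp.ext (hf.trans (toL2_ae_eq hmeas htrace f).symm)
      rw [Set.mem_ofPred_eq, this, ← ContinuousLinearMap.adjoint_inner_left, h0, inner_zero_left]
    have h2 := hall (e i)
    rw [real_inner_self_eq_norm_sq, e.orthonormal.1 i] at h2
    norm_num at h2
  exact pow_pos (norm_pos_iff.2 hne) 2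

/-- The images of the eigenfunctions in the reproducing kernel Hilbert space, normalised. -/
noncomputable def eigenvec (μ : ι → ℝ) (e : HilbertBasis ι ℝ (Lp ℝ 2 ν)) (i : ι) : H :=
  (Real.sqrt (μ i))⁻¹ • ContinuousLinearMap.adjoint (toL2 hmeas htrace) (e i)

theorem orthonormal_eigenvec (hdense : DenseInL2 H ν) (heig : IsEigensystem (kern H) ν μ e) :
    Orthonormal ℝ (eigenvec hmeas htrace μ e) := by
  classical
  rw [orthonormal_iff_ite]
  intro i j
  have hi := eigenvalue_pos hmeas htrace hdense heig i
  rw [eigenvec, eigenvec, inner_smul_left, inner_smul_right, inner_adjoint_eigen _ _ heig]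
  split_ifs with h
  · subst h
    have : Real.sqrt (μ i) ≠ 0 := by positivity
    simp only [conj_trivial]
    field_simp
    exact (Real.sq_sqrt hi.le).symm
  · simp

theorem inner_toL2_eigen (hdense : DenseInL2 H ν) (heig : IsEigensystem (kern H) ν μ e) (g : H)
    (i : ι) : inner ℝ (e i) (toL2 hmeas htrace g)
      = Real.sqrt (μ i) * inner ℝ (eigenvec hmeas htrace μ e i) g := by
  have hi := eigenvalue_pos hmeas htrace hdense heig i
  rw [eigenvec, inner_smul_left, ContinuousLinearMap.adjoint_inner_left, conj_trivial,
    mul_inv_cancel_left₀ (by positivity)]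

theorem toL2_eigenvec (hdense : DenseInL2 H ν) (heig : IsEigensystem (kern H) ν μ e) (i : ι) :
    toL2 hmeas htrace (eigenvec hmeas htrace μ e i) = Real.sqrt (μ i) • e i := by
  have hi := eigenvalue_pos hmeas htrace hdense heig i
  rw [eigenvec, map_smul, toL2_adjoint_eigen _ _ heig, smul_smul]
  congr 1
  have : Real.sqrt (μ i) ≠ 0 := by positivity
  field_simp
  exact (Real.sq_sqrt hi.le).symm

theorem eigenvec_ae_eq (hdense : DenseInL2 H ν) (heig : IsEigensystem (kern H) ν μ e) (i : ι) :
    (eigenvec hmeas htrace μ e i : H) =ᵐ[ν] fun x => Real.sqrt (μ i) * e i x := by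
  have h := toL2_ae_eq hmeas htrace (eigenvec hmeas htrace μ e i)
  rw [toL2_eigenvec _ _ hdense heig] at h
  filter_upwards [h, Lp.coeFn_smul (Real.sqrt (μ i)) (e i)] with x h1 h2
  rw [← h1, h2]; simp

theorem norm_toL2_sq (g : H) : ‖toL2 hmeas htrace g‖ ^ 2 = ∫ x, g x ^ 2 ∂ν := by
  rw [← real_inner_self_eq_norm_sq, inner_toL2]
  refine integral_congr_ae ?_
  filter_upwards [toL2_ae_eq hmeas htrace g] with x hx
  rw [hx, pow_two]

-- Bessel's inequality for the kernel section at `x` gives `∑ h_i(x)² ≤ k(x, x)`, where `h_i` is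
-- `eigenvec`; integrate, using that `h_i` has squared L² norm `μ_i`.
include hmeas htrace in
theorem summable_eigenvalue (hdense : DenseInL2 H ν) (heig : IsEigensystem (kern H) ν μ e) :
    Summable μ := by
  refine summable_of_sum_le (c := ∫ x, kern H x x ∂ν)
    (fun i => (eigenvalue_pos hmeas htrace hdense heig i).le) fun s => ?_
  have h1 : ∀ i, μ i = ∫ x, (eigenvec hmeas htrace μ e i) x ^ 2 ∂ν := by
    intro i
    rw [← norm_toL2_sq hmeas htrace, toL2_eigenvec _ _ hdense heig, norm_smul, e.orthonormal.1 i,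
      mul_one, Real.norm_of_nonneg (Real.sqrt_nonneg _),
      Real.sq_sqrt (eigenvalue_pos hmeas htrace hdense heig i).le]
  have hi : ∀ i, Integrable (fun x => (eigenvec hmeas htrace μ e i) x ^ 2) ν := fun i =>
    (memLp_coe hmeas htrace _).integrable_sq
  rw [Finset.sum_congr rfl fun i _ => h1 i, ← integral_finsetSum _ fun i _ => hi i]
  refine integral_mono (integrable_finsetSum _ fun i _ => hi i) htrace fun x => ?_
  have := (orthonormal_eigenvec hmeas htrace hdense heig).sum_inner_products_le
    (RKHS.kerFun H x (1 : ℝ)) (s := s)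
  simp only [kern_eq_inner, real_inner_self_eq_norm_sq]
  refine le_trans (le_of_eq (Finset.sum_congr rfl fun i _ => ?_)) this
  rw [real_inner_comm, inner_kerFun_one, Real.norm_eq_abs, sq_abs]

theorem hasSum_norm_toL2_sq (hdense : DenseInL2 H ν) (heig : IsEigensystem (kern H) ν μ e) (g : H) :
    HasSum (fun i => μ i * inner ℝ (eigenvec hmeas htrace μ e i) g ^ 2)
      (‖toL2 hmeas htrace g‖ ^ 2) := by
  rw [← real_inner_self_eq_norm_sq]
  refine (e.hasSum_inner_mul_inner (toL2 hmeas htrace g)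
    (toL2 hmeas htrace g)).congr_fun fun i => ?_
  rw [real_inner_comm (e i), inner_toL2_eigen _ _ hdense heig, ← pow_two, mul_pow,
    Real.sq_sqrt (eigenvalue_pos hmeas htrace hdense heig i).le]

/-- The inclusion need not be injective. A countable dense subset of its kernel and continuity of
evaluation yield one null set valid for all `g`. -/
theorem ae_forall_apply_eq_zero [TopologicalSpace.SeparableSpace H] :
    ∀ᵐ x ∂ν, ∀ g : H, toL2 hmeas htrace g = 0 → g x = 0 := by
  have : SecondCountableTopology H := UniformSpace.secondCountable_of_separable H
  obtain ⟨D, hDc, hDd⟩ := TopologicalSpace.exists_countable_dense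
    (LinearMap.ker (toL2 hmeas htrace).toLinearMap)
  have h1 : ∀ᵐ x ∂ν, ∀ g ∈ D, (g : H) x = 0 := by
    rw [ae_ball_iff hDc]
    intro g _
    have h2 := toL2_ae_eq hmeas htrace (g : H)
    have h3 : toL2 hmeas htrace (g : H) = 0 := g.2
    rw [h3] at h2
    filter_upwards [h2, Lp.coeFn_zero ℝ 2 ν] with x h4 h5
    rw [← h4, h5]; rfl
  filter_upwards [h1] with x hx g hg
  have hcl : IsClosed {k : LinearMap.ker (toL2 hmeas htrace).toLinearMap | (k : H) x = 0} :=
    isClosed_eq ((RKHS.continuous_eval (H := H) x).comp continuous_subtype_val) continuous_const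
  exact hcl.closure_subset_iff.2 (fun k hk => hx k hk) (hDd ⟨g, hg⟩)

/-- The family `eigenvec` may be incomplete in `H`, but `g` differs from its projection by an
element that is zero in L², hence zero at almost every point. -/
theorem ae_hasSum_eigenvec [TopologicalSpace.SeparableSpace H] (hdense : DenseInL2 H ν)
    (heig : IsEigensystem (kern H) ν μ e) :
    ∀ᵐ x ∂ν, ∀ g : H, HasSum (fun i => inner ℝ (eigenvec hmeas htrace μ e i) g
      * eigenvec hmeas htrace μ e i x) (g x) := by
  filter_upwards [ae_forall_apply_eq_zero hmeas htrace] with x hx g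
  set h := eigenvec hmeas htrace μ e with hh
  have ho : Orthonormal ℝ h := orthonormal_eigenvec hmeas htrace hdense heig
  have hs : Summable fun i => inner ℝ (h i) g • h i := by
    have := (ho.orthogonalFamily.summable_iff_norm_sq_summable (fun i => inner ℝ (h i) g)).2
    simp only [LinearIsometry.toSpanSingleton_apply] at this
    exact this (ho.inner_products_summable g)
  obtain ⟨g1, hg1⟩ := hs
  have hker : toL2 hmeas htrace (g - g1) = 0 := by
    have hc : ∀ i, inner ℝ (h i) g1 = inner ℝ (h i) g := by
      intro i
      classical
      have h1 := hg1.mapL (innerSL ℝ (h i))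
      have h2 : HasSum (fun j => innerSL ℝ (h i) (inner ℝ (h j) g • h j)) (inner ℝ (h i) g) := by
        refine (hasSum_ite_eq i (inner ℝ (h i) g)).congr_fun fun j => ?_
        rw [innerSL_apply_apply, inner_smul_right, orthonormal_iff_ite.1 ho]
        split_ifs with h1 h2 h2
        · rw [mul_one, h1]
        · exact absurd h1.symm h2
        · exact absurd h2.symm h1
        · rw [mul_zero]
      exact h1.unique h2
    have h3 := hasSum_norm_toL2_sq hmeas htrace hdense heig (g - g1)
    simp only [← hh, inner_sub_right, hc, sub_self] at h3
    have h4 : HasSum (fun _ : ι => (0 : ℝ)) 0 := hasSum_zero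
    have h5 := h3.unique (h4.congr_fun fun i => by simp)
    simpa using h5
  have h5 := hx _ hker
  have h6 : g x = g1 x := by
    rw [RKHS.coe_sub, Pi.sub_apply] at h5; linarith
  rw [h6]
  have h7 := hg1.mapL (innerSL ℝ (RKHS.kerFun H x (1 : ℝ)))
  rw [innerSL_apply_apply, inner_kerFun_one] at h7
  refine h7.congr_fun fun i => ?_
  rw [innerSL_apply_apply, inner_smul_right, inner_kerFun_one]

theorem sq_integral_le_integral_sq [IsProbabilityMeasure ν] {f : S → ℝ} (hf : MemLp f 2 ν) :
    (∫ x, f x ∂ν) ^ 2 ≤ ∫ x, f x ^ 2 ∂ν := by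
  have := variance_nonneg f ν
  rw [variance_eq_sub hf] at this
  simpa using this

/-- Here `p` is the interpolant with coefficients `K⁻¹ f(x)`. Symmetry of `K` turns `(K⁻¹ z) · f(x)`
into the integral of `p`, and the residual `f - p` is a function vanishing at the nodes. -/
theorem abs_estimator_sub_integral_le [IsProbabilityMeasure ν] {n : ℕ} {x : Fin n → S}
    (hdet : IsUnit (gram (kern H) x).det) {C : ℝ}
    (hC : ∀ g : H, (∀ j, g (x j) = 0) → ‖toL2 hmeas htrace g‖ ≤ C * ‖g‖) (hC0 : 0 ≤ C) (f : H) :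
    |estimator (kern H) ν x f - ∫ t, f t ∂ν| ≤ C * ‖f‖ := by
  set K := gram (kern H) x with hK
  have hKs : K.transpose = K := by
    ext i j; simp [hK, gram, kern_comm (x i)]
  set β : Fin n → ℝ := K⁻¹.mulVec fun j => f (x j) with hβ
  set p : H := ∑ j, β j • RKHS.kerFun H (x j) (1 : ℝ) with hp
  have hpx : ∀ i, p (x i) = f (x i) := by
    intro i
    have h1 : p (x i) = ∑ j, β j * kern H (x i) (x j) := by
      rw [← inner_kerFun_one, hp, inner_sum]
      exact Finset.sum_congr rfl fun j _ => by rw [inner_smul_right, kern_eq_inner]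
    have h2 : K.mulVec β = fun j => f (x j) := by
      rw [hβ, Matrix.mulVec_mulVec, Matrix.mul_nonsing_inv _ hdet, Matrix.one_mulVec]
    rw [h1, ← congrFun h2 i]
    simp [Matrix.mulVec, dotProduct, hK, gram, mul_comm]
  have hint : ∀ g : H, Integrable g ν := fun g => (memLp_coe hmeas htrace g).integrable (by norm_num)
  have hest : estimator (kern H) ν x f = ∫ t, p t ∂ν := by
    have h1 : ∫ t, p t ∂ν = ∑ j, β j * ∫ t, kern H t (x j) ∂ν := by
      have h2 : ∀ t, p t = ∑ j, β j * kern H t (x j) := by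
        intro t
        rw [← inner_kerFun_one, hp, inner_sum]
        exact Finset.sum_congr rfl fun j _ => by rw [inner_smul_right, kern_eq_inner]
      have h3 : ∀ j, Integrable (fun t => kern H t (x j)) ν := by
        intro j
        refine (hint (RKHS.kerFun H (x j) (1 : ℝ))).congr (Filter.Eventually.of_forall fun t => ?_)
        simp only
        rw [kern_eq_inner, inner_kerFun_one]
      simp_rw [h2]
      rw [integral_finsetSum _ fun j _ => (h3 j).const_mul _]
      simp_rw [integral_const_mul]
    rw [h1, estimator]
    change dotProduct (weights (kern H) ν x) (fun j => f (x j))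
      = dotProduct β fun j => ∫ t, kern H t (x j) ∂ν
    rw [weights, ← hK, hβ, dotProduct_comm, Matrix.dotProduct_mulVec,
      ← Matrix.mulVec_transpose, Matrix.transpose_nonsing_inv, hKs]
  have horth : inner ℝ (f - p) p = 0 := by
    rw [hp, inner_sum]
    refine Finset.sum_eq_zero fun j _ => ?_
    rw [inner_smul_right, real_inner_comm, inner_kerFun_one, ← hp, RKHS.coe_sub, Pi.sub_apply, hpx,
      sub_self, mul_zero]
  have hnorm : ‖f - p‖ ≤ ‖f‖ := by
    have h1 : ‖f‖ ^ 2 = ‖f - p‖ ^ 2 + ‖p‖ ^ 2 := by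
      have := norm_add_sq_real (f - p) p
      rw [horth, sub_add_cancel] at this
      linarith
    exact le_of_sq_le_sq (by nlinarith [sq_nonneg ‖p‖]) (norm_nonneg _)
  have hint2 : |∫ t, (f - p) t ∂ν| ≤ ‖toL2 hmeas htrace (f - p)‖ := by
    rw [← sq_le_sq₀ (abs_nonneg _) (norm_nonneg _), sq_abs, norm_toL2_sq]
    exact sq_integral_le_integral_sq (memLp_coe hmeas htrace (f - p))
  rw [hest, abs_sub_comm, ← integral_sub (hint f) (hint p)]
  rw [RKHS.coe_sub] at hint2
  refine (hint2.trans (hC _ fun j => ?_)).trans (mul_le_mul_of_nonneg_left hnorm hC0)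
  rw [RKHS.coe_sub, Pi.sub_apply, hpx, sub_self]

end Embedding

/-! ### The sampling distribution and the reweighted features -/

section Leverage

variable {S : Type*} [MeasurableSpace S] {ν : Measure S} {ι : Type*} {μ : ι → ℝ}
  {e : HilbertBasis ι ℝ (Lp ℝ 2 ν)} {lam : ℝ}

theorem measurable_leverage [Countable ι] : Measurable (leverage μ e lam) := by
  refine Measurable.tsum fun i => ENNReal.measurable_ofReal.comp ?_
  exact ((Lp.stronglyMeasurable (e i)).measurable.pow_const 2).const_mul _

theorem integral_eigen_mul [DecidableEq ι] (i j : ι) :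
    ∫ x, e i x * e j x ∂ν = if i = j then 1 else 0 := by
  have h := orthonormal_iff_ite.1 e.orthonormal i j
  rw [L2.inner_def] at h
  rw [← h]
  refine integral_congr_ae (Filter.Eventually.of_forall fun x => ?_)
  simp [mul_comm]

theorem integrable_eigen_mul (i j : ι) : Integrable (fun x => e i x * e j x) ν :=
  (Lp.memLp (e i)).integrable_mul (Lp.memLp (e j))

theorem div_add_nonneg (hμ : ∀ i, 0 < μ i) (hlam : 0 < lam) (i : ι) : 0 ≤ μ i / (μ i + lam) :=
  div_nonneg (hμ i).le (add_pos (hμ i) hlam).le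

theorem div_add_le_one (hμ : ∀ i, 0 < μ i) (hlam : 0 < lam) (i : ι) : μ i / (μ i + lam) ≤ 1 := by
  rw [div_le_one (add_pos (hμ i) hlam)]; linarith

theorem summable_div_add (hμ : ∀ i, 0 < μ i) (hsum : Summable μ) (hlam : 0 < lam) :
    Summable fun i => μ i / (μ i + lam) := by
  refine (hsum.div_const lam).of_nonneg_of_le (div_add_nonneg hμ hlam) fun i => ?_
  have := hμ i
  gcongr
  linarith

theorem lintegral_leverage [Countable ι] (hμ : ∀ i, 0 < μ i) (hsum : Summable μ)
    (hlam : 0 < lam) :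
    ∫⁻ x, leverage μ e lam x ∂ν = ENNReal.ofReal (degreesOfFreedom μ lam) := by
  classical
  have hm : ∀ i, AEMeasurable (fun x => ENNReal.ofReal (μ i / (μ i + lam) * (e i x) ^ 2)) ν :=
    fun i => (ENNReal.measurable_ofReal.comp
      (((Lp.stronglyMeasurable (e i)).measurable.pow_const 2).const_mul _)).aemeasurable
  simp only [leverage]
  rw [lintegral_tsum hm,
    degreesOfFreedom, ENNReal.ofReal_tsum_of_nonneg (div_add_nonneg hμ hlam)
      (summable_div_add hμ hsum hlam)]
  congr 1
  ext i
  have hi : Integrable (fun x => μ i / (μ i + lam) * (e i x) ^ 2) ν := by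
    simpa only [pow_two] using (integrable_eigen_mul (e := e) i i).const_mul _
  rw [← ofReal_integral_eq_lintegral_ofReal hi (Filter.Eventually.of_forall fun x =>
    mul_nonneg (div_add_nonneg hμ hlam i) (sq_nonneg _)), integral_const_mul]
  simp only [pow_two]
  rw [integral_eigen_mul, if_pos rfl, mul_one]

theorem bachMeasure_absolutelyContinuous : bachMeasure μ e lam ≪ ν :=
  (withDensity_absolutelyContinuous ν _).smul_left _

theorem isProbabilityMeasure_bachMeasure [Countable ι] (hμ : ∀ i, 0 < μ i) (hsum : Summable μ)
    (hlam : 0 < lam) (hd : 0 < degreesOfFreedom μ lam) :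
    IsProbabilityMeasure (bachMeasure μ e lam) := by
  refine ⟨?_⟩
  rw [bachMeasure, Measure.smul_apply, withDensity_apply _ MeasurableSet.univ, Measure.restrict_univ,
    lintegral_leverage hμ hsum hlam, smul_eq_mul]
  exact ENNReal.inv_mul_cancel (by simpa using hd) ENNReal.ofReal_ne_top

/-- The eigenfunctions, reweighted so as to have bounded norm and covariance `μ / (μ + lam)` under
`bachMeasure`. -/
noncomputable def feature (μ : ι → ℝ) (e : HilbertBasis ι ℝ (Lp ℝ 2 ν)) (lam : ℝ) (x : S) (i : ι) :
    ℝ :=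
  Real.sqrt (degreesOfFreedom μ lam / (leverage μ e lam x).toReal) *
    (Real.sqrt (μ i / (μ i + lam)) * e i x)

theorem measurable_feature [Countable ι] (i : ι) : Measurable fun x => feature μ e lam x i :=
  (measurable_leverage.ennreal_toReal.const_div _).sqrt.mul
    ((Lp.stronglyMeasurable (e i)).measurable.const_mul _)

theorem sum_feature_sq_le (hμ : ∀ i, 0 < μ i) (hlam : 0 < lam)
    (hd : 0 < degreesOfFreedom μ lam) (s : Finset ι) (x : S) :
    ∑ i ∈ s, feature μ e lam x i * feature μ e lam x i ≤ degreesOfFreedom μ lam := by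
  set d := degreesOfFreedom μ lam
  set l := leverage μ e lam x with hl
  have h1 : ∀ i, feature μ e lam x i * feature μ e lam x i
      = d / l.toReal * (μ i / (μ i + lam) * (e i x) ^ 2) := by
    intro i
    rw [feature, ← hl, mul_mul_mul_comm, Real.mul_self_sqrt (by positivity), mul_mul_mul_comm,
      Real.mul_self_sqrt (div_add_nonneg hμ hlam i), pow_two]
  simp_rw [h1, ← Finset.mul_sum]
  -- Where the leverage is `0` or `∞`, division by zero makes the features vanish.
  by_cases h0 : l.toReal = 0
  · rw [h0]; simpa using hd.le
  have htop : l ≠ ∞ := fun h => h0 (by simp [h])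
  have h2 : ∑ i ∈ s, (μ i / (μ i + lam) * (e i x) ^ 2) ≤ l.toReal := by
    rw [← ENNReal.ofReal_le_iff_le_toReal htop, ENNReal.ofReal_sum_of_nonneg fun i _ =>
      mul_nonneg (div_add_nonneg hμ hlam i) (sq_nonneg _)]
    exact ENNReal.sum_le_tsum s
  have h3 : 0 < l.toReal := lt_of_le_of_ne ENNReal.toReal_nonneg (Ne.symm h0)
  calc d / l.toReal * _ ≤ d / l.toReal * l.toReal := by gcongr
    _ = d := div_mul_cancel₀ _ h0

/-- The density `leverage / d` cancels the squared weight `d / leverage`, leaving the orthonormality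
relations of `e`. -/
theorem integral_feature_mul [Countable ι] [DecidableEq ι] (hμ : ∀ i, 0 < μ i) (hsum : Summable μ)
    (hlam : 0 < lam) (hd : 0 < degreesOfFreedom μ lam) (i j : ι) :
    ∫ x, feature μ e lam x i * feature μ e lam x j ∂(bachMeasure μ e lam)
      = if i = j then μ i / (μ i + lam) else 0 := by
  have hfin : ∀ᵐ x ∂ν, leverage μ e lam x < ∞ :=
    ae_lt_top measurable_leverage (by rw [lintegral_leverage hμ hsum hlam]; exact ENNReal.ofReal_ne_top)
  rw [bachMeasure, integral_smul_measure,
    integral_withDensity_eq_integral_toReal_smul measurable_leverage hfin,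
    lintegral_leverage hμ hsum hlam, ENNReal.toReal_inv, ENNReal.toReal_ofReal hd.le]
  set d := degreesOfFreedom μ lam
  have h1 : ∫ x, (leverage μ e lam x).toReal • (feature μ e lam x i * feature μ e lam x j) ∂ν
      = ∫ x, d * (Real.sqrt (μ i / (μ i + lam)) * Real.sqrt (μ j / (μ j + lam)))
        * (e i x * e j x) ∂ν := by
    refine integral_congr_ae ?_
    filter_upwards [hfin] with x hx
    set l := leverage μ e lam x with hl
    have h2 : l.toReal • (feature μ e lam x i * feature μ e lam x j) = l.toReal * (d / l.toReal) *
        (Real.sqrt (μ i / (μ i + lam)) * Real.sqrt (μ j / (μ j + lam))) * (e i x * e j x) := by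
      rw [feature, feature, ← hl, mul_mul_mul_comm, Real.mul_self_sqrt (by positivity), smul_eq_mul]
      ring
    rw [h2]
    -- The cancellation fails at zero leverage, but there every `e i x` is zero.
    by_cases h0 : l = 0
    · have h3 := ENNReal.tsum_eq_zero.1 h0 i
      rw [ENNReal.ofReal_eq_zero] at h3
      have h4 : 0 < μ i / (μ i + lam) := div_pos (hμ i) (add_pos (hμ i) hlam)
      have h5 : e i x = 0 := by
        by_contra h6
        have : 0 < (e i x) ^ 2 := by positivity
        exact absurd h3 (not_le.2 (mul_pos h4 this))
      simp [h5]
    · rw [mul_div_cancel₀ _ (ENNReal.toReal_ne_zero.2 ⟨h0, hx.ne⟩)]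
  rw [h1, integral_const_mul, integral_eigen_mul, smul_eq_mul]
  split_ifs with h
  · subst h
    rw [Real.mul_self_sqrt (div_add_nonneg hμ hlam i)]
    field_simp
  · simp

end Leverage

/-! ### Numerical constants -/

section Numeric

theorem exp_le_quadratic {t : ℝ} (ht : t ≤ 5 / 8) : Real.exp t ≤ 1 + t + 4 / 5 * t ^ 2 := by
  rcases le_total t 0 with h | h
  · have h1 := Real.quadratic_le_exp_of_nonneg (neg_nonneg.2 h)
    have h2 : Real.exp t * Real.exp (-t) = 1 := by rw [← Real.exp_add]; simp
    have h3 := Real.exp_pos t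
    have h4 : Real.exp t * (1 + -t + (-t) ^ 2 / 2) ≤ 1 :=
      (mul_le_mul_of_nonneg_left h1 h3.le).trans_eq h2
    have h5 : Real.exp t ≤ 1 + t + t ^ 2 / 2 := by
      by_contra! h6
      have h7 : 0 < 1 + -t + (-t) ^ 2 / 2 := by
        linarith [div_nonneg (sq_nonneg (-t)) zero_le_two]
      -- `(1 + t + t²/2) (1 - t + t²/2) = 1 + t⁴/4 ≥ 1`.
      nlinarith [mul_lt_mul_of_pos_right h6 h7, sq_nonneg (t ^ 2)]
    nlinarith [sq_nonneg t]
  · have h1 := Real.exp_bound' h (by linarith) (n := 3) (by norm_num)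
    norm_num [Finset.sum_range_succ, Nat.factorial] at h1
    nlinarith [mul_nonneg (mul_nonneg h h) (sub_nonneg.2 ht)]

/-- With `q = n / (5d)` the numerator is at most `d exp q` and the denominator at least `exp (2q) /
2`, while `exp q ≥ 16 d / δ`; the quotient is at most `δ / 8`. -/
theorem tail_bound_lt {d δ : ℝ} (hd : 4 / 5 < d) (hδ0 : 0 < δ) (hδ1 : δ < 1) {n : ℕ}
    (hn : 5 * d * Real.log (16 * d / δ) ≤ n) :
    0 < n ∧ 0 < (n : ℝ) * (1 / (2 * d)) * (4 / 5) ∧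
    d * (1 + 4 / 5 * (1 / (2 * d)) ^ 2 * d) ^ n /
      (Real.exp ((n : ℝ) * (1 / (2 * d)) * (4 / 5)) - (n : ℝ) * (1 / (2 * d)) * (4 / 5) - 1) < δ := by
  have hd0 : 0 < d := by linarith
  have h16 : 12 < 16 * d / δ := by rw [lt_div_iff₀ hδ0]; nlinarith
  set q : ℝ := n / (5 * d) with hq
  have hlog : Real.log (16 * d / δ) ≤ q := by
    rw [hq, le_div_iff₀ (by positivity)]; linarith
  have hlog0 : 0 < Real.log (16 * d / δ) := Real.log_pos (by linarith)
  have hE : 16 * d / δ ≤ Real.exp q := (Real.log_le_iff_le_exp (by positivity)).1 hlog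
  have hq0 : 0 < q := hlog0.trans_le hlog
  have hL : (n : ℝ) * (1 / (2 * d)) * (4 / 5) = 2 * q := by rw [hq]; field_simp; norm_num
  have hv : 4 / 5 * (1 / (2 * d)) ^ 2 * d = 1 / (5 * d) := by field_simp; norm_num
  have hn0 : 0 < n := by
    rcases Nat.eq_zero_or_pos n with h | h
    · rw [hq, h] at hq0; simp at hq0
    · exact h
  refine ⟨hn0, by rw [hL]; linarith, ?_⟩
  rw [hL, hv]
  have hpow : (1 + 1 / (5 * d)) ^ n ≤ Real.exp q := by
    have h1 : 1 + 1 / (5 * d) ≤ Real.exp (1 / (5 * d)) := by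
      linarith [Real.add_one_le_exp (1 / (5 * d))]
    refine (pow_le_pow_left₀ (by positivity) h1 n).trans_eq ?_
    rw [← Real.exp_nat_mul, hq]; congr 1; ring
  have h2q : Real.exp (2 * q) = Real.exp q ^ 2 := by rw [two_mul, Real.exp_add, pow_two]
  have hqE := Real.add_one_le_exp q
  set E := Real.exp q
  -- From `E > 12` and `E ≥ q + 1`, `E² / 2 ≥ 6 (q + 1)`.
  have hden : E ^ 2 / 2 ≤ Real.exp (2 * q) - 2 * q - 1 := by rw [h2q]; nlinarith
  have hE0 : 0 < E := Real.exp_pos q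
  have hdE : 16 * d ≤ E * δ := (div_le_iff₀ hδ0).1 hE
  rw [div_lt_iff₀ (lt_of_lt_of_le (by positivity) hden)]
  calc d * (1 + 1 / (5 * d)) ^ n ≤ d * E := by gcongr
    _ < δ * (E ^ 2 / 2) := by nlinarith
    _ ≤ _ := by gcongr

end Numeric

/-! ### From concentration to functions vanishing at the nodes -/

section Main

open Matrix in
theorem form_sum_deviation {m : Type*} [Fintype m] [DecidableEq m] {n : ℕ} (c : m → ℝ) (θ : ℝ)
    (a : Fin n → m → ℝ) (u : m → ℝ) :
    u ⬝ᵥ (∑ k, deviation c θ (a k)) *ᵥ u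
      = ∑ k, θ * (∑ i, c i * u i ^ 2 - (∑ i, a k i * u i) ^ 2) := by
  rw [Matrix.sum_mulVec, dotProduct_sum]
  refine Finset.sum_congr rfl fun k _ => ?_
  rw [deviation, smul_mulVec, sub_mulVec, dotProduct_smul, dotProduct_sub, smul_eq_mul,
    vecMulVec_mulVec, op_smul_eq_smul, dotProduct_smul, smul_eq_mul, dotProduct_comm u (a k),
    ← pow_two]
  congr 2
  refine Finset.sum_congr rfl fun i _ => ?_
  rw [mulVec_diagonal]; ring

variable {S : Type*} [MeasurableSpace S] {ν : Measure S} {ι : Type*} {μ : ι → ℝ}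
  {e : HilbertBasis ι ℝ (Lp ℝ 2 ν)} {lam : ℝ}

/-- The sample violates the spectral lower bound on the span of the eigenfunctions in `s`. -/
def SpectralViolation (μ : ι → ℝ) (e : HilbertBasis ι ℝ (Lp ℝ 2 ν)) (lam θ L : ℝ) {n : ℕ}
    (x : Fin n → S) (s : Finset ι) : Prop :=
  ∃ u : ι → ℝ, L * ∑ i ∈ s, u i ^ 2 < ∑ k, θ * (∑ i ∈ s, μ i / (μ i + lam) * u i ^ 2
    - (∑ i ∈ s, feature μ e lam (x k) i * u i) ^ 2)

/-- Extend the witness by zero. -/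
theorem SpectralViolation.mono {θ L : ℝ} {n : ℕ} {x : Fin n → S} {s t : Finset ι} (hst : s ⊆ t)
    (h : SpectralViolation μ e lam θ L x s) : SpectralViolation μ e lam θ L x t := by
  classical
  obtain ⟨u, hu⟩ := h
  refine ⟨fun i => if i ∈ s then u i else 0, ?_⟩
  have hz : ∀ f : ι → ℝ → ℝ, (∀ i, f i 0 = 0) →
      ∑ i ∈ t, f i (if i ∈ s then u i else 0) = ∑ i ∈ s, f i (u i) := by
    intro f hf
    rw [← Finset.sum_subset hst fun i _ hi => by rw [if_neg hi, hf]]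
    exact Finset.sum_congr rfl fun i hi => by rw [if_pos hi]
  rw [hz (fun _ y => y ^ 2) (by simp), hz (fun i y => μ i / (μ i + lam) * y ^ 2) (by simp)]
  refine hu.trans_eq (Finset.sum_congr rfl fun k _ => ?_)
  rw [hz (fun i y => feature μ e lam (x k) i * y) (by simp)]

theorem measure_spectralViolation_le [Countable ι] (hμ : ∀ i, 0 < μ i) (hsum : Summable μ)
    (hlam : 0 < lam) (hd : 4 / 5 < degreesOfFreedom μ lam) {n : ℕ} {L : ℝ} (hL : 0 < L)
    {Ω : Type*} [MeasurableSpace Ω] {P : Measure Ω} [IsProbabilityMeasure P] {X : Fin n → Ω → S}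
    (hlaw : ∀ j, HasLaw (X j) (bachMeasure μ e lam) P) (hindep : iIndepFun X P) (s : Finset ι) :
    P {ω | SpectralViolation μ e lam (1 / (2 * degreesOfFreedom μ lam)) L (fun j => X j ω) s}
      ≤ ENNReal.ofReal (degreesOfFreedom μ lam * (1 + 4 / 5 * (1 / (2 * degreesOfFreedom μ lam)) ^ 2
        * degreesOfFreedom μ lam) ^ n / (Real.exp L - L - 1)) := by
  classical
  set d := degreesOfFreedom μ lam with hdd
  have hd0 : 0 < d := by linarith
  have := isProbabilityMeasure_bachMeasure (e := e) hμ hsum hlam hd0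
  -- This is where `d > 4/5` enters: it keeps `θ` in the range of `exp_le_quadratic`.
  have hθ : 1 / (2 * d) ≤ 5 / 8 := by rw [div_le_iff₀ (by positivity)]; linarith
  have hcD : ∑ i : s, μ i / (μ i + lam) ≤ d := by
    rw [Finset.sum_coe_sort s fun i => μ i / (μ i + lam)]
    exact (summable_div_add hμ hsum hlam).sum_le_tsum s fun i _ => div_add_nonneg hμ hlam i
  refine (measure_mono ?_).trans (measure_exists_lt_form_le (m := s)
    (a := fun x i => feature μ e lam x i) (c := fun i => μ i / (μ i + lam))
    (fun i => measurable_feature (i : ι)) (D := d) (fun x => ?_)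
    (fun i => div_add_nonneg hμ hlam i) (fun i => div_add_le_one hμ hlam i) hcD (fun i j => ?_)
    (θ := 1 / (2 * d)) (κ := 4 / 5) (by positivity) (by norm_num)
    (fun t ht => exp_le_quadratic (ht.trans hθ)) n hL hlaw hindep)
  · rintro ω ⟨u, hu⟩
    refine ⟨fun i => u i, ?_⟩
    rw [form_sum_deviation, dotProduct]
    simp only [← pow_two]
    rw [Finset.sum_coe_sort s fun i => u i ^ 2,
      Finset.sum_coe_sort s fun i => μ i / (μ i + lam) * u i ^ 2]
    refine hu.trans_eq (Finset.sum_congr rfl fun k _ => ?_)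
    rw [Finset.sum_coe_sort s fun i => feature μ e lam (X k ω) i * u i]
  · rw [dotProduct, Finset.sum_coe_sort s fun i => feature μ e lam x i * feature μ e lam x i]
    exact sum_feature_sq_le hμ hlam hd0 s x
  · rw [integral_feature_mul hμ hsum hlam hd0, Matrix.diagonal_apply]
    simp only [Subtype.ext_iff]

/-- The finite bound does not depend on `s`, and the measure of an increasing union is the supremum
of the measures, so passing to infinitely many eigenfunctions costs nothing. -/
theorem measure_exists_spectralViolation_le [Countable ι] (hμ : ∀ i, 0 < μ i) (hsum : Summable μ)
    (hlam : 0 < lam) (hd : 4 / 5 < degreesOfFreedom μ lam) {n : ℕ} {L : ℝ} (hL : 0 < L)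
    {Ω : Type*} [MeasurableSpace Ω] {P : Measure Ω} [IsProbabilityMeasure P] {X : Fin n → Ω → S}
    (hlaw : ∀ j, HasLaw (X j) (bachMeasure μ e lam) P) (hindep : iIndepFun X P) :
    P {ω | ∃ s, SpectralViolation μ e lam (1 / (2 * degreesOfFreedom μ lam)) L (fun j => X j ω) s}
      ≤ ENNReal.ofReal (degreesOfFreedom μ lam * (1 + 4 / 5 * (1 / (2 * degreesOfFreedom μ lam)) ^ 2
        * degreesOfFreedom μ lam) ^ n / (Real.exp L - L - 1)) := by
  classical
  have hU : {ω | ∃ s, SpectralViolation μ e lam (1 / (2 * degreesOfFreedom μ lam)) L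
      (fun j => X j ω) s} = ⋃ s, {ω | SpectralViolation μ e lam (1 / (2 * degreesOfFreedom μ lam)) L
      (fun j => X j ω) s} := by ext ω; simp
  have hm : Monotone fun s => {ω | SpectralViolation μ e lam (1 / (2 * degreesOfFreedom μ lam)) L
      (fun j => X j ω) s} := fun s t hst ω hω => SpectralViolation.mono hst hω
  rw [hU, hm.measure_iUnion]
  exact iSup_le fun s => measure_spectralViolation_le hμ hsum hlam hd hL hlaw hindep s

variable {H : Type*} [NormedAddCommGroup H] [InnerProductSpace ℝ H] [RKHS ℝ H S ℝ]
  [CompleteSpace H]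
  (hmeas : Measurable fun p : S × S => kern H p.1 p.2)
  (htrace : Integrable (fun x => kern H x x) ν)

theorem norm_toL2_sq_le_of_le_four_mul (hdense : DenseInL2 H ν)
    (heig : IsEigensystem (kern H) ν μ e) (hle : ∀ i, μ i ≤ 4 * lam) (hlam : 0 < lam) (g : H) :
    ‖toL2 hmeas htrace g‖ ^ 2 ≤ 4 * lam * ‖g‖ ^ 2 := by
  have ho := orthonormal_eigenvec hmeas htrace hdense heig
  have hb : Summable fun i => inner ℝ (eigenvec hmeas htrace μ e i) g ^ 2 := by
    simpa only [Real.norm_eq_abs, sq_abs] using ho.inner_products_summable g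
  have hle2 : ∑' i, inner ℝ (eigenvec hmeas htrace μ e i) g ^ 2 ≤ ‖g‖ ^ 2 := by
    simpa only [Real.norm_eq_abs, sq_abs] using ho.tsum_inner_products_le g
  refine (hasSum_le (fun i => ?_) (hasSum_norm_toL2_sq hmeas htrace hdense heig g)
    (hb.hasSum.mul_left (4 * lam))).trans (by gcongr)
  exact mul_le_mul_of_nonneg_right (hle i) (sq_nonneg _)

theorem norm_toL2_sq_le_of_not_spectralViolation (hdense : DenseInL2 H ν)
    (heig : IsEigensystem (kern H) ν μ e) (hlam : 0 < lam) {n : ℕ} (hn : 0 < n) {θ : ℝ}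
    (hθ : 0 < θ) {x : Fin n → S}
    (hx : ¬ ∃ s, SpectralViolation μ e lam θ (n * θ * (4 / 5)) x s)
    (hexpand : ∀ k, ∀ g : H, HasSum (fun i => inner ℝ (eigenvec hmeas htrace μ e i) g
      * eigenvec hmeas htrace μ e i (x k)) (g (x k)))
    (heval : ∀ k i, (eigenvec hmeas htrace μ e i : H) (x k) = Real.sqrt (μ i) * e i (x k))
    {g : H} (hg : ∀ k, g (x k) = 0) :
    ‖toL2 hmeas htrace g‖ ^ 2 ≤ 4 * lam * ‖g‖ ^ 2 := by
  have hμ := eigenvalue_pos hmeas htrace hdense heig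
  have ho := orthonormal_eigenvec hmeas htrace hdense heig
  set γ : ι → ℝ := fun i => inner ℝ (eigenvec hmeas htrace μ e i) g with hγ
  have hb : Summable fun i => γ i ^ 2 := by
    simpa only [Real.norm_eq_abs, sq_abs] using ho.inner_products_summable g
  have hle2 : ∑' i, γ i ^ 2 ≤ ‖g‖ ^ 2 := by
    simpa only [Real.norm_eq_abs, sq_abs] using ho.tsum_inner_products_le g
  have hT := hasSum_norm_toL2_sq hmeas htrace hdense heig g
  set T := ‖toL2 hmeas htrace g‖ ^ 2
  set G := ∑' i, γ i ^ 2
  set u : ι → ℝ := fun i => Real.sqrt (μ i + lam) * γ i with hu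
  have hu2 : ∀ i, u i ^ 2 = (μ i + lam) * γ i ^ 2 := fun i => by
    rw [hu, mul_pow, Real.sq_sqrt (add_pos (hμ i) hlam).le]
  have hs1 : HasSum (fun i => μ i / (μ i + lam) * u i ^ 2) T := hT.congr_fun fun i => by
    rw [hu2]
    have := add_pos (hμ i) hlam
    field_simp
    rfl
  have hs2 : HasSum (fun i => u i ^ 2) (T + lam * G) :=
    (hT.add (hb.hasSum.mul_left lam)).congr_fun fun i => by rw [hu2]; ring
  -- The factor `√(μ_i + λ)` in `u` cancels the one in the feature, leaving a multiple of the
  -- expansion of `g (x k) = 0`.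
  have hs3 : ∀ k, HasSum (fun i => feature μ e lam (x k) i * u i) 0 := by
    intro k
    have h1 := (hexpand k g).mul_left
      (Real.sqrt (degreesOfFreedom μ lam / (leverage μ e lam (x k)).toReal))
    rw [hg k, mul_zero] at h1
    refine h1.congr_fun fun i => ?_
    rw [heval, feature, hu, Real.sqrt_div (hμ i).le]
    have : Real.sqrt (μ i + lam) ≠ 0 := (Real.sqrt_pos.2 (add_pos (hμ i) hlam)).ne'
    field_simp
    rfl
  have hfin : ∀ s : Finset ι, ∑ k : Fin n, θ * (∑ i ∈ s, μ i / (μ i + lam) * u i ^ 2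
      - (∑ i ∈ s, feature μ e lam (x k) i * u i) ^ 2) ≤ n * θ * (4 / 5) * ∑ i ∈ s, u i ^ 2 := by
    intro s
    by_contra! hcon
    exact hx ⟨s, u, hcon⟩
  -- Limit of the finite inequalities along the finite subsets of `ι`.
  have hlim : ∑ k : Fin n, θ * (T - 0 ^ 2) ≤ n * θ * (4 / 5) * (T + lam * G) := by
    refine le_of_tendsto_of_tendsto' (tendsto_finsetSum _ fun k _ =>
      (Filter.Tendsto.sub hs1 ((hs3 k).pow 2)).const_mul θ) (hs2.const_mul _) hfin
  simp only [Finset.sum_const, Finset.card_univ, Fintype.card_fin, nsmul_eq_mul] at hlim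
  have hnθ : 0 < (n : ℝ) * θ := mul_pos (by exact_mod_cast hn) hθ
  have h5 : T ≤ 4 / 5 * (T + lam * G) := by
    refine le_of_mul_le_mul_left ?_ hnθ
    linarith
  have h6 := mul_le_mul_of_nonneg_left hle2 hlam.le
  linarith

end Main

end KernelQuadrature

/-! ### The quadrature bound -/

theorem theorem2 {S : Type*} [MeasurableSpace S] (ν : Measure S) [IsProbabilityMeasure ν]
    (H : Type*) [NormedAddCommGroup H] [InnerProductSpace ℝ H] [RKHS ℝ H S ℝ]
    [CompleteSpace H] [TopologicalSpace.SeparableSpace H]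
    (hmeas : Measurable fun p : S × S => KernelQuadrature.kern H p.1 p.2)
    (htrace : Integrable (fun x => KernelQuadrature.kern H x x) ν)
    (hdense : KernelQuadrature.DenseInL2 H ν)
    {ι : Type*} [Countable ι] (μ : ι → ℝ) (e : HilbertBasis ι ℝ (Lp ℝ 2 ν))
    (heig : KernelQuadrature.IsEigensystem (KernelQuadrature.kern H) ν μ e)
    (lam : ℝ) (hlam : 0 < lam) (δ : ℝ) (hδ0 : 0 < δ) (hδ1 : δ < 1)
    (n : ℕ)
    (hn : 5 * KernelQuadrature.degreesOfFreedom μ lam *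
      Real.log (16 * KernelQuadrature.degreesOfFreedom μ lam / δ) ≤ (n : ℝ))
    {Ω : Type*} [MeasurableSpace Ω] (P : Measure Ω) [IsProbabilityMeasure P]
    (X : Fin n → Ω → S)
    (hlaw : ∀ j, HasLaw (X j) (KernelQuadrature.bachMeasure μ e lam) P)
    (hindep : iIndepFun X P)
    (hinv : ∀ᵐ ω ∂P, IsUnit (KernelQuadrature.gram (KernelQuadrature.kern H)
      fun j => X j ω).det) :
    ENNReal.ofReal (1 - δ) <
      P {ω | ∀ f : H,
        |KernelQuadrature.estimator (KernelQuadrature.kern H) ν (fun j => X j ω) (fun x => f x)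
          - ∫ x, f x ∂ν| ≤ 2 * Real.sqrt lam * ‖f‖} := by
  have hμ := KernelQuadrature.eigenvalue_pos hmeas htrace hdense heig
  have hsum := KernelQuadrature.summable_eigenvalue hmeas htrace hdense heig
  have hcd : ∀ i, μ i / (μ i + lam) ≤ KernelQuadrature.degreesOfFreedom μ lam := fun i =>
    (KernelQuadrature.summable_div_add hμ hsum hlam).le_tsum i fun j _ =>
      KernelQuadrature.div_add_nonneg hμ hlam j
  have hfinal : ∀ x : Fin n → S,
      IsUnit (KernelQuadrature.gram (KernelQuadrature.kern H) x).det →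
      (∀ g : H, (∀ j, g (x j) = 0) →
        ‖KernelQuadrature.toL2 hmeas htrace g‖ ^ 2 ≤ 4 * lam * ‖g‖ ^ 2) →
      ∀ f : H, |KernelQuadrature.estimator (KernelQuadrature.kern H) ν x (fun x => f x)
          - ∫ x, f x ∂ν| ≤ 2 * Real.sqrt lam * ‖f‖ := by
    intro x hdet hg f
    refine KernelQuadrature.abs_estimator_sub_integral_le hmeas htrace hdet (fun g hgx => ?_)
      (by positivity) f
    refine le_of_sq_le_sq ?_ (by positivity)
    rw [mul_pow, mul_pow, Real.sq_sqrt hlam.le]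
    linarith [hg g hgx]
  -- In the first case each `μ_i / (μ_i + λ) ≤ 4/5`, that is `μ_i ≤ 4 λ`, and the bound holds for
  -- every invertible sample.
  rcases le_or_gt (KernelQuadrature.degreesOfFreedom μ lam) (4 / 5) with hd | hd
  · have hle : ∀ i, μ i ≤ 4 * lam := by
      intro i
      have h1 := (hcd i).trans hd
      rw [div_le_iff₀ (add_pos (hμ i) hlam)] at h1
      linarith
    have hone : P {ω | ∀ f : H,
        |KernelQuadrature.estimator (KernelQuadrature.kern H) ν (fun j => X j ω) (fun x => f x)
          - ∫ x, f x ∂ν| ≤ 2 * Real.sqrt lam * ‖f‖} = 1 := by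
      rw [← measure_univ (μ := P)]
      refine measure_congr (Filter.eventuallyEq_univ.2 ?_)
      filter_upwards [hinv] with ω hω
      exact hfinal _ hω fun g _ =>
        KernelQuadrature.norm_toL2_sq_le_of_le_four_mul hmeas htrace hdense heig hle hlam g
    rw [hone, ← ENNReal.ofReal_one]
    exact (ENNReal.ofReal_lt_ofReal_iff one_pos).2 (by linarith)
  · obtain ⟨hn0, hL, hB⟩ := KernelQuadrature.tail_bound_lt hd hδ0 hδ1 hn
    have hbad := KernelQuadrature.measure_exists_spectralViolation_le hμ hsum hlam hd hL hlaw hindep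
    -- The sampling law is absolutely continuous with respect to `ν`, so the pointwise expansions
    -- hold at all nodes almost surely.
    have hae : ∀ p : S → Prop, (∀ᵐ x ∂ν, p x) → ∀ᵐ ω ∂P, ∀ j, p (X j ω) := by
      intro p hp
      rw [ae_all_iff]
      intro j
      refine ae_of_ae_map (hlaw j).aemeasurable ?_
      rw [(hlaw j).map_eq]
      exact KernelQuadrature.bachMeasure_absolutelyContinuous.ae_le hp
    have hcover : ∀ᵐ ω ∂P, ω ∈ {ω | ∀ f : H,
        |KernelQuadrature.estimator (KernelQuadrature.kern H) ν (fun j => X j ω) (fun x => f x)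
          - ∫ x, f x ∂ν| ≤ 2 * Real.sqrt lam * ‖f‖} ∪
        {ω | ∃ s, KernelQuadrature.SpectralViolation μ e lam
          (1 / (2 * KernelQuadrature.degreesOfFreedom μ lam))
          (n * (1 / (2 * KernelQuadrature.degreesOfFreedom μ lam)) * (4 / 5))
          (fun j => X j ω) s} := by
      filter_upwards [hinv,
        hae _ (KernelQuadrature.ae_hasSum_eigenvec hmeas htrace hdense heig),
        hae _ (ae_all_iff.2 fun i =>
          KernelQuadrature.eigenvec_ae_eq hmeas htrace hdense heig i)] with ω h1 h2 h3
      by_cases hv : ∃ s, KernelQuadrature.SpectralViolation μ e lam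
          (1 / (2 * KernelQuadrature.degreesOfFreedom μ lam))
          (n * (1 / (2 * KernelQuadrature.degreesOfFreedom μ lam)) * (4 / 5))
          (fun j => X j ω) s
      · exact Or.inr hv
      · exact Or.inl (hfinal _ h1 fun g hg =>
          KernelQuadrature.norm_toL2_sq_le_of_not_spectralViolation hmeas htrace hdense heig hlam
            hn0 (by positivity) hv h2 h3 hg)
    -- Only subadditivity on the almost sure cover is used, so measurability of the good event is
    -- not needed.
    by_contra! hcon
    have h0 := (measure_congr (Filter.eventuallyEq_univ.2 hcover)).trans (measure_univ (μ := P))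
    have h1 := h0.ge.trans ((measure_union_le _ _).trans (add_le_add hcon hbad))
    rw [← ENNReal.ofReal_add (by linarith) ?_, ENNReal.one_le_ofReal] at h1
    · linarith
    · have := Real.add_one_lt_exp hL.ne'
      have : 0 < KernelQuadrature.degreesOfFreedom μ lam := by linarith
      refine div_nonneg (by positivity) (by linarith)
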